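/- Let $\|\cdot\|$ be a norm on $\mathbb{R}^d$ and let $\mathcal{Y}$ be a measurable space. Let $H:\mathbb{R}^d\times\mathcal{Y}\to\mathbb{R}^d$ be measurable in $y$, with a constant $L_h$ such that $\|H(w,y)-H(w',y)\|\le L_h\|w-w'\|$ for all $w,w',y$, and with $\sup_{y}\|H(0,y)\|<\infty$. Let $P$ be a Markov transition kernel on $\mathcal{Y}$ with a unique stationary distribution $d_{\mathcal{Y}}$ which mixes geometrically: there are $\varrho\in[0,1)$ and a constant $C_1$ such that $$\int_{\mathcal{Y}}|P^n(y,dy')-d_{\mathcal{Y}}(dy')|\le C_1\varrho^n\qquad\text{for all } y\in\mathcal{Y},\ n\ge 0 .$$ Put $h(w)=\int H(w,y)\,d_{\mathcal{Y}}(dy)$ and assume that $\|h(w)-h(w')\|\le\kappa\|w-w'\|$ for all $w,w'$, for some $\kappa\in[0,1)$. Let $Y_1,Y_2,\dots$ be a Markov chain with kernel $P$ with respect to a filtration $(\mathcal{F}_t)_{t\ge0}$, let $w_0$ be deterministic or, more generally, $\mathcal{F}_0$-measurable and almost surely bounded by a deterministic constant, and let $$w_{t+1}=w_t+\alpha_t\,(H(w_t,Y_{t+1})-w_t),\qquad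 \alpha_t=\frac{C_\alpha}{(t+3)\ln^{\nu}(t+3)},\qquad t=0,1,2,\dots,$$ with $\nu\in(0,1)$. Then $h$ has a unique fixed point $w_*$, and there is a constant $\bar C_\alpha>0$ such that for every $C_\alpha\ge\bar C_\alpha$ there are deterministic constants $C_{Th}>0$, $C_{Th}'>0$ and an integer $C\ge1$ (independent of $t$, $\delta$ and $p$) with the following two properties, where $$a(t)=C_{Th}\exp\Big(-\frac{\ln^{1-\nu}(t+1)}{1-\nu}\Big),\qquad b(t)=C_{Th}'+\frac{\ln^{1-\nu}(t+1)}{1-\nu}.$$ (1) For every $\delta\in(0,1)$, with probability at least $1-\delta$, $$\|w_t-w_*\|^2\le a(t)\,\big[\ln(1/\delta)+b(t)\big]^{C}\qquad\text{for all } t\ge0 .$$ (2) For every real $p\ge2$ and every integer $t\ge0$, $\|w_t-w_*\|^{2p}$ is integrable and $$\mathbb{E}\,\|w_t-w_*\|^{2p}\le\big(a(t)\,b(t)^{C}\big)^p+C\,p\,a(t)^p\,e^{b(t)}\,(Cp)!\,,$$ where $x!$ means $\Gamma(x+1)$ for real $x$. -/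

import Mathlib

open MeasureTheory ProbabilityTheory

namespace StochApprox

/-- The iterates `w_{t+1} = w_t + α_t (H(w_t, Y_{t+1}) - w_t)` started at `w0`. -/
def iterates {E 𝒴 Ω : Type*} [NormedAddCommGroup E] [NormedSpace ℝ E]
    (H : E → 𝒴 → E) (α : ℕ → ℝ) (Y : ℕ → Ω → 𝒴) (w0 : Ω → E) : ℕ → Ω → E
  | 0 => w0
  | t + 1 => fun ω =>
      iterates H α Y w0 t ω +
        α t • (H (iterates H α Y w0 t ω) (Y (t + 1) ω) - iterates H α Y w0 t ω)

/-- The samples `Y_1, Y_2, …` form a time-homogeneous Markov chain with transition kernel `P` with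
respect to the filtration `ℱ`. The variable `Y_0` is never used by the algorithm, and nothing is
required of it. -/
structure IsMarkovChain {𝒴 Ω : Type*} [MeasurableSpace 𝒴] {mΩ : MeasurableSpace Ω}
    (μ : Measure Ω) (ℱ : Filtration ℕ mΩ) (P : Kernel 𝒴 𝒴) (Y : ℕ → Ω → 𝒴) : Prop where
  adapted : ∀ n, 1 ≤ n → Measurable[ℱ n] (Y n)
  markov : ∀ n, 1 ≤ n → ∀ A : Set 𝒴, MeasurableSet A →
    μ[(Y (n + 1) ⁻¹' A).indicator (fun _ => (1 : ℝ)) | ℱ n] =ᵐ[μ] fun ω => (P (Y n ω)).real A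

/-- The total variation norm `∫ |dμ₁ - dμ₂|` of the difference of two finite measures (with total
mass not halved). For measures with densities it is the `L¹` distance of the densities. -/
noncomputable def tvNorm {𝒴 : Type*} [MeasurableSpace 𝒴] (μ₁ μ₂ : Measure 𝒴)
    [IsFiniteMeasure μ₁] [IsFiniteMeasure μ₂] : ENNReal :=
  (μ₁.toSignedMeasure - μ₂.toSignedMeasure).totalVariation Set.univ

instance isMarkovKernel_pow {𝒴 : Type*} [MeasurableSpace 𝒴] (P : Kernel 𝒴 𝒴) [IsMarkovKernel P]
    (n : ℕ) : IsMarkovKernel (P ^ n) := by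
  induction n with
  | zero => rw [pow_zero]; exact inferInstanceAs (IsMarkovKernel (Kernel.id : Kernel 𝒴 𝒴))
  | succ n ih => rw [pow_succ]; exact inferInstanceAs (IsMarkovKernel ((P ^ n) ∘ₖ P))

/-- The kernel `P` has `d` as its unique stationary distribution and mixes geometrically,
uniformly in the initial state. -/
structure GeometricallyMixing {𝒴 : Type*} [MeasurableSpace 𝒴] (P : Kernel 𝒴 𝒴) [IsMarkovKernel P]
    (d : Measure 𝒴) [IsProbabilityMeasure d] : Prop where
  stationary : P.Invariant d
  unique : ∀ d' : Measure 𝒴, IsProbabilityMeasure d' → P.Invariant d' → d' = d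
  mixing : ∃ ϱ C : ℝ, 0 ≤ ϱ ∧ ϱ < 1 ∧
    ∀ (y : 𝒴) (n : ℕ), tvNorm ((P ^ n) y) d ≤ ENNReal.ofReal (C * ϱ ^ n)

/-- The mean operator `h(w) = E_{y ∼ d}[H(w, y)]`. -/
noncomputable def meanOp {E 𝒴 : Type*} [NormedAddCommGroup E] [NormedSpace ℝ E]
    [MeasurableSpace 𝒴] (d : Measure 𝒴) (H : E → 𝒴 → E) (w : E) : E :=
  ∫ y, H w y ∂d

/-- A map is a contraction for the norm of `E`. -/
def IsContraction {E : Type*} [NormedAddCommGroup E] (h : E → E) : Prop :=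
  ∃ κ : ℝ, 0 ≤ κ ∧ κ < 1 ∧ ∀ w w' : E, ‖h w - h w'‖ ≤ κ * ‖w - w'‖

/-- `H` is measurable in `y`, Lipschitz in `w` uniformly in `y`, and bounded at `w = 0`. -/
structure IsRegularUpdate {E 𝒴 : Type*} [NormedAddCommGroup E] [MeasurableSpace E]
    [MeasurableSpace 𝒴] (H : E → 𝒴 → E) : Prop where
  measurable : ∀ w, Measurable (H w)
  lipschitz : ∃ L : ℝ, ∀ (w w' : E) (y : 𝒴), ‖H w y - H w' y‖ ≤ L * ‖w - w'‖
  bounded : BddAbove (Set.range fun y => ‖H 0 y‖)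

/-- The learning rates `α_t = Cα / ((t + 3) ln^ν (t + 3))`. -/
noncomputable def learningRate (Cα ν : ℝ) (t : ℕ) : ℝ :=
  Cα / (((t : ℝ) + 3) * Real.log ((t : ℝ) + 3) ^ ν)

/-- The time scale `ln^{1-ν}(t + 1) / (1 - ν)`. -/
noncomputable def timeScale (ν : ℝ) (t : ℕ) : ℝ :=
  Real.log ((t : ℝ) + 1) ^ (1 - ν) / (1 - ν)

/-- `a(t) = C_Th exp(- ln^{1-ν}(t + 1) / (1 - ν))`. -/
noncomputable def rateA (CTh ν : ℝ) (t : ℕ) : ℝ :=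
  CTh * Real.exp (-timeScale ν t)

/-- `b(t) = C'_Th + ln^{1-ν}(t + 1) / (1 - ν)`. -/
noncomputable def rateB (CTh' ν : ℝ) (t : ℕ) : ℝ :=
  CTh' + timeScale ν t

/-- The factorial `x!` of a real number, `Γ(x + 1)`. -/
noncomputable def realFactorial (x : ℝ) : ℝ := Real.Gamma (x + 1)

theorem realFactorial_natCast (n : ℕ) : realFactorial (n : ℝ) = (Nat.factorial n : ℝ) :=
  Real.Gamma_nat_eq_factorial n

end StochApprox

/-! Write `h = meanOp d H` and split each step into the relaxed contraction towards `h (w t)` and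
the noise `ξ t = H (w t) (Y (t+1)) - h (w t)`. Geometric mixing solves the Poisson equation `V w - P
(V w) = H w - h w`; with `W w = P (V w)`, the noise is a martingale difference `V (w t) (Y (t+1)) -
W (w t) (Y t)` plus `W (w t) (Y t) - W (w t) (Y (t+1))`, which telescopes up to the small drift of
`w` (`exists_isPoissonPair`).

No stability argument is needed. Since `ν > 0`, the sum of the learning rates is `o(log t)`, so the
pathwise Gronwall bound on `‖w t‖` is smaller than any power of `t`, and so are the inverse products
`1 / ∏ (1 - α j)`. The weights `α i / ∏ (1 - α j)` times this growth are therefore `O(i^(-3/4))`.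
They are square summable, so the weighted martingale has exponential moments bounded uniformly in
time (`exists_weightedSum_tail`), while summation by parts bounds the telescoping part by a constant
(`IsTameStep.exists_norm_sum_le`).

Subtracting the response of the linear recursion to the noise leaves a noise-free recursion, which
contracts in the given norm, whatever that norm is (`norm_le_decay_mul`). The error decays like `∏
(1 - (1-κ) α j)`, up to powers of `log t` and `log (1/δ)`. As the learning rates sum to at least `Cα
* timeScale` up to a constant, `Cα ≥ 1/(1-κ)` yields `exp (-timeScale)`, and powers of `log t` are
powers of `timeScale` (`exists_sq_norm_sub_le_rate`). The moments follow by integrating the tail at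
a fixed time (`integral_rpow_le_of_tail`). -/

set_option linter.unusedSectionVars false

namespace StochApprox

/-! ### Differences of integrals and total variation -/

section TotalVariation

variable {E 𝒴 : Type*} [NormedAddCommGroup E] [NormedSpace ℝ E] [MeasurableSpace 𝒴]

/-- The Jordan decomposition of `μ₁ - μ₂`, rearranged so that only positive measures occur and
ordinary integrals can be used. -/
theorem exists_add_eq_add (μ₁ μ₂ : Measure 𝒴) [IsFiniteMeasure μ₁] [IsFiniteMeasure μ₂] :
    ∃ p n : Measure 𝒴, IsFiniteMeasure p ∧ IsFiniteMeasure n ∧ μ₁ + n = μ₂ + p ∧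
      tvNorm μ₁ μ₂ = p Set.univ + n Set.univ := by
  set s : SignedMeasure 𝒴 := μ₁.toSignedMeasure - μ₂.toSignedMeasure with hs
  refine ⟨s.toJordanDecomposition.posPart, s.toJordanDecomposition.negPart, inferInstance,
    inferInstance, ?_, by simp [tvNorm, SignedMeasure.totalVariation, ← hs]⟩
  have h := s.toSignedMeasure_toJordanDecomposition
  rw [JordanDecomposition.toSignedMeasure] at h
  rw [← Measure.toSignedMeasure_eq_toSignedMeasure_iff, Measure.toSignedMeasure_add,
    Measure.toSignedMeasure_add]
  have h2 := h.trans hs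
  rw [sub_eq_sub_iff_add_eq_add] at h2
  rw [← h2, add_comm]

theorem abs_integral_sub_le_tvNorm (μ₁ μ₂ : Measure 𝒴) [IsFiniteMeasure μ₁] [IsFiniteMeasure μ₂]
    {g : 𝒴 → ℝ} (hg : Measurable g) {M c : ℝ} (hM : ∀ y, |g y| ≤ M) (hM0 : 0 ≤ M) (hc : 0 ≤ c)
    (h : tvNorm μ₁ μ₂ ≤ ENNReal.ofReal c) :
    |∫ y, g y ∂μ₁ - ∫ y, g y ∂μ₂| ≤ M * c := by
  obtain ⟨p, n, hp, hn, he, htv⟩ := exists_add_eq_add μ₁ μ₂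
  have hint : ∀ (m : Measure 𝒴) [IsFiniteMeasure m], Integrable g m := fun m _ =>
    Integrable.of_bound hg.aestronglyMeasurable M (Filter.Eventually.of_forall hM)
  have h1 : ∫ y, g y ∂μ₁ + ∫ y, g y ∂n = ∫ y, g y ∂μ₂ + ∫ y, g y ∂p := by
    rw [← integral_add_measure (hint _) (hint _), ← integral_add_measure (hint _) (hint _), he]
  have hb : ∀ (m : Measure 𝒴) [IsFiniteMeasure m], |∫ y, g y ∂m| ≤ M * m.real Set.univ :=
    fun m _ => by
      simpa only [Real.norm_eq_abs] using norm_integral_le_of_norm_le_const (μ := m) (f := g)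
        (Filter.Eventually.of_forall hM)
  have h2 : p.real Set.univ + n.real Set.univ ≤ c := by
    rw [Measure.real, Measure.real, ← ENNReal.toReal_add (measure_ne_top _ _) (measure_ne_top _ _),
      ← htv]
    exact ENNReal.toReal_le_of_le_ofReal hc h
  calc |∫ y, g y ∂μ₁ - ∫ y, g y ∂μ₂| = |∫ y, g y ∂p - ∫ y, g y ∂n| := by
        congr 1; linarith
    _ ≤ |∫ y, g y ∂p| + |∫ y, g y ∂n| := abs_sub _ _
    _ ≤ M * p.real Set.univ + M * n.real Set.univ := add_le_add (hb p) (hb n)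
    _ ≤ M * c := by rw [← mul_add]; exact mul_le_mul_of_nonneg_left h2 hM0

/-- A norming functional from Hahn–Banach reduces to the scalar case, without a constant depending
on the dimension. -/
theorem norm_integral_sub_le_tvNorm [CompleteSpace E] [MeasurableSpace E] [BorelSpace E]
    [SecondCountableTopology E]
    (μ₁ μ₂ : Measure 𝒴) [IsFiniteMeasure μ₁] [IsFiniteMeasure μ₂]
    {g : 𝒴 → E} (hg : Measurable g) {M c : ℝ} (hM : ∀ y, ‖g y‖ ≤ M) (hM0 : 0 ≤ M) (hc : 0 ≤ c)
    (h : tvNorm μ₁ μ₂ ≤ ENNReal.ofReal c) :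
    ‖∫ y, g y ∂μ₁ - ∫ y, g y ∂μ₂‖ ≤ M * c := by
  obtain ⟨f, hf1, hf⟩ := exists_dual_vector'' ℝ (∫ y, g y ∂μ₁ - ∫ y, g y ∂μ₂)
  have hint : ∀ (m : Measure 𝒴) [IsFiniteMeasure m], Integrable g m := fun m _ =>
    Integrable.of_bound hg.aestronglyMeasurable M (Filter.Eventually.of_forall hM)
  have h1 : ‖∫ y, g y ∂μ₁ - ∫ y, g y ∂μ₂‖ = ∫ y, f (g y) ∂μ₁ - ∫ y, f (g y) ∂μ₂ := by
    rw [f.integral_comp_comm (hint _), f.integral_comp_comm (hint _), ← map_sub, hf]; rfl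
  rw [h1]
  refine (le_abs_self _).trans (abs_integral_sub_le_tvNorm μ₁ μ₂ (f.measurable.comp hg)
    (fun y => ?_) hM0 hc h)
  calc |f (g y)| ≤ ‖f‖ * ‖g y‖ := f.le_opNorm _
    _ ≤ 1 * M := mul_le_mul hf1 (hM y) (norm_nonneg _) zero_le_one
    _ = M := one_mul M

end TotalVariation

/-! ### The Poisson equation of a geometrically mixing kernel -/

section Poisson

variable {E 𝒴 : Type*} [NormedAddCommGroup E] [NormedSpace ℝ E] [CompleteSpace E]
  [MeasurableSpace E] [BorelSpace E] [SecondCountableTopology E] [MeasurableSpace 𝒴]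
  {P : Kernel 𝒴 𝒴} [IsMarkovKernel P] {d : Measure 𝒴} [IsProbabilityMeasure d]

/-- The deviation of the `n`-step average of `g` from its stationary average. -/
noncomputable def deviation (P : Kernel 𝒴 𝒴) (d : Measure 𝒴) (g : 𝒴 → E) (n : ℕ) (y : 𝒴) : E :=
  ∫ y', g y' ∂((P ^ n) y) - ∫ y', g y' ∂d

/-- The potential `∑ₙ (Pⁿ g - d(g))`, a solution of the Poisson equation of `P` for `g`. -/
noncomputable def potential (P : Kernel 𝒴 𝒴) (d : Measure 𝒴) (g : 𝒴 → E) (y : 𝒴) : E :=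
  ∑' n, deviation P d g n y

theorem integrable_of_bounded {g : 𝒴 → E} (hg : Measurable g) {M : ℝ} (hM : ∀ y, ‖g y‖ ≤ M)
    (m : Measure 𝒴) [IsFiniteMeasure m] : Integrable g m :=
  Integrable.of_bound hg.aestronglyMeasurable M (Filter.Eventually.of_forall hM)

theorem measurable_deviation {g : 𝒴 → E} (hg : Measurable g) (n : ℕ) :
    Measurable (deviation P d g n) := by
  have h : StronglyMeasurable fun y => ∫ y', g y' ∂((P ^ n) y) :=
    hg.stronglyMeasurable.integral_kernel
  exact h.measurable.sub_const _

theorem deviation_zero {g : 𝒴 → E} (hg : Measurable g) (y : 𝒴) :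
    deviation P d g 0 y = g y - ∫ y', g y' ∂d := by
  have : (P ^ 0) y = Measure.dirac y := by
    rw [pow_zero]; exact Kernel.id_apply y
  rw [deviation, this, integral_dirac' _ _ hg.stronglyMeasurable]

theorem deviation_sub {g g' : 𝒴 → E} (hg : Measurable g) (hg' : Measurable g') {M M' : ℝ}
    (hM : ∀ y, ‖g y‖ ≤ M) (hM' : ∀ y, ‖g' y‖ ≤ M') (n : ℕ) (y : 𝒴) :
    deviation P d (fun y => g y - g' y) n y = deviation P d g n y - deviation P d g' n y := by
  rw [deviation, integral_sub (integrable_of_bounded hg hM _) (integrable_of_bounded hg' hM' _),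
    integral_sub (integrable_of_bounded hg hM _) (integrable_of_bounded hg' hM' _), deviation,
    deviation]
  abel

theorem integral_deviation {g : 𝒴 → E} (hg : Measurable g) {M : ℝ} (hM : ∀ y, ‖g y‖ ≤ M)
    (n : ℕ) (y : 𝒴) : ∫ y', deviation P d g n y' ∂(P y) = deviation P d g (n + 1) y := by
  have h : StronglyMeasurable fun y => ∫ y', g y' ∂((P ^ n) y) :=
    hg.stronglyMeasurable.integral_kernel
  have hb : ∀ y, ‖∫ y', g y' ∂((P ^ n) y)‖ ≤ M := fun y => by
    simpa using norm_integral_le_of_norm_le_const (μ := (P ^ n) y) (f := g)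
      (Filter.Eventually.of_forall hM)
  have hp : (P ^ (n + 1)) y = ((P ^ n) ∘ₖ P) y := by rw [pow_succ]; rfl
  simp only [deviation]
  rw [integral_sub (integrable_of_bounded h.measurable hb _) (integrable_const _), hp,
    Kernel.integral_comp (integrable_of_bounded hg hM _)]
  simp

variable {C ϱ : ℝ}

theorem norm_deviation_le (hC : 0 ≤ C) (hϱ : 0 ≤ ϱ)
    (hmix : ∀ (y : 𝒴) (n : ℕ), tvNorm ((P ^ n) y) d ≤ ENNReal.ofReal (C * ϱ ^ n))
    {g : 𝒴 → E} (hg : Measurable g) {M : ℝ} (hM0 : 0 ≤ M) (hM : ∀ y, ‖g y‖ ≤ M) (n : ℕ) (y : 𝒴) :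
    ‖deviation P d g n y‖ ≤ M * C * ϱ ^ n := by
  rw [mul_assoc]
  exact norm_integral_sub_le_tvNorm _ _ hg hM hM0 (by positivity) (hmix y n)

variable (hC : 0 ≤ C) (hϱ : 0 ≤ ϱ) (hϱ1 : ϱ < 1)
  (hmix : ∀ (y : 𝒴) (n : ℕ), tvNorm ((P ^ n) y) d ≤ ENNReal.ofReal (C * ϱ ^ n))

include hC hϱ hϱ1 hmix

theorem summable_deviation {g : 𝒴 → E} (hg : Measurable g) {M : ℝ} (hM0 : 0 ≤ M)
    (hM : ∀ y, ‖g y‖ ≤ M) (y : 𝒴) : Summable fun n => deviation P d g n y :=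
  Summable.of_norm_bounded ((summable_geometric_of_lt_one hϱ hϱ1).mul_left (M * C))
    fun n => norm_deviation_le hC hϱ hmix hg hM0 hM n y

theorem norm_potential_le {g : 𝒴 → E} (hg : Measurable g) {M : ℝ} (hM0 : 0 ≤ M)
    (hM : ∀ y, ‖g y‖ ≤ M) (y : 𝒴) : ‖potential P d g y‖ ≤ M * (C * (1 - ϱ)⁻¹) := by
  rw [← mul_assoc]
  exact tsum_of_norm_bounded ((hasSum_geometric_of_lt_one hϱ hϱ1).mul_left (M * C))
    fun n => norm_deviation_le hC hϱ hmix hg hM0 hM n y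

theorem potential_sub {g g' : 𝒴 → E} (hg : Measurable g) (hg' : Measurable g') {M M' : ℝ}
    (hM0 : 0 ≤ M) (hM0' : 0 ≤ M') (hM : ∀ y, ‖g y‖ ≤ M) (hM' : ∀ y, ‖g' y‖ ≤ M') (y : 𝒴) :
    potential P d (fun y => g y - g' y) y = potential P d g y - potential P d g' y := by
  simp only [potential, deviation_sub hg hg' hM hM']
  exact (summable_deviation hC hϱ hϱ1 hmix hg hM0 hM y).tsum_sub
    (summable_deviation hC hϱ hϱ1 hmix hg' hM0' hM' y)

theorem measurable_potential {g : 𝒴 → E} (hg : Measurable g) {M : ℝ} (hM0 : 0 ≤ M)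
    (hM : ∀ y, ‖g y‖ ≤ M) : Measurable (potential P d g) := by
  refine measurable_of_tendsto_metrizable
    (f := fun n y => ∑ i ∈ Finset.range n, deviation P d g i y) (fun n => ?_) ?_
  · exact Finset.measurable_fun_sum _ fun i _ => measurable_deviation hg i
  · rw [tendsto_pi_nhds]
    exact fun y => (summable_deviation hC hϱ hϱ1 hmix hg hM0 hM y).hasSum.tendsto_sum_nat

/-- Averaging over `P` shifts the series by one index, so exactly the term of index `0`, the centred
`g`, is lost. The geometric bound allows exchanging sum and integral. -/
theorem integral_potential {g : 𝒴 → E} (hg : Measurable g) {M : ℝ} (hM0 : 0 ≤ M)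
    (hM : ∀ y, ‖g y‖ ≤ M) (y : 𝒴) :
    ∫ y', potential P d g y' ∂(P y) = potential P d g y - (g y - ∫ y', g y' ∂d) := by
  have hb := norm_deviation_le hC hϱ hmix hg hM0 hM
  have h := hasSum_integral_of_summable_integral_norm (μ := P y) (F := deviation P d g)
    (fun n => integrable_of_bounded (measurable_deviation hg n) (hb n) _)
    (Summable.of_nonneg_of_le (fun n => integral_nonneg fun _ => norm_nonneg _)
      (fun n => ?_) ((summable_geometric_of_lt_one hϱ hϱ1).mul_left (M * C)))
  · simp only [integral_deviation hg hM] at h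
    have h2 := (hasSum_nat_add_iff' 1).2 (summable_deviation hC hϱ hϱ1 hmix hg hM0 hM y).hasSum
    rw [Finset.sum_range_one, deviation_zero hg] at h2
    exact h.unique h2
  · have := integral_mono_of_nonneg (μ := P y) (f := fun a => ‖deviation P d g n a‖)
      (g := fun _ => M * C * ϱ ^ n) (Filter.Eventually.of_forall fun _ => norm_nonneg _)
      (integrable_const _) (Filter.Eventually.of_forall (hb n))
    simpa using this

end Poisson

/-- Solutions `V w` of the Poisson equations of a regular update function, with `W w = P (V w)`,
bounded by `K (1 + ‖w‖)` and `K`-Lipschitz in `w`. -/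
structure IsPoissonPair {E 𝒴 : Type*} [NormedAddCommGroup E] [NormedSpace ℝ E] [MeasurableSpace E]
    [MeasurableSpace 𝒴] (P : Kernel 𝒴 𝒴) (d : Measure 𝒴) (H V W : E → 𝒴 → E) (K : ℝ) : Prop where
  nonneg : 0 ≤ K
  measurable_left : ∀ w, Measurable (V w)
  measurable_right : ∀ w, Measurable (W w)
  bound_left : ∀ w y, ‖V w y‖ ≤ K * (1 + ‖w‖)
  bound_right : ∀ w y, ‖W w y‖ ≤ K * (1 + ‖w‖)
  lipschitz_left : ∀ w w' y, ‖V w y - V w' y‖ ≤ K * ‖w - w'‖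
  lipschitz_right : ∀ w w' y, ‖W w y - W w' y‖ ≤ K * ‖w - w'‖
  sub_eq : ∀ w y, V w y - W w y = H w y - meanOp d H w
  integral_eq : ∀ w y, ∫ y', V w y' ∂(P y) = W w y

theorem IsRegularUpdate.exists_bound {E 𝒴 : Type*} [NormedAddCommGroup E] [MeasurableSpace E]
    [MeasurableSpace 𝒴] {H : E → 𝒴 → E} (hH : IsRegularUpdate H) :
    ∃ L : ℝ, 0 ≤ L ∧ (∀ (w w' : E) (y : 𝒴), ‖H w y - H w' y‖ ≤ L * ‖w - w'‖) ∧
      ∀ w y, ‖H w y‖ ≤ L * (1 + ‖w‖) := by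
  obtain ⟨L, hL⟩ := hH.lipschitz
  obtain ⟨B, hB⟩ := hH.bounded
  have hB' : ∀ y, ‖H 0 y‖ ≤ B := fun y => hB ⟨y, rfl⟩
  have hL' : ∀ (w w' : E) (y : 𝒴), ‖H w y - H w' y‖ ≤ max (max L B) 0 * ‖w - w'‖ :=
    fun w w' y => (hL w w' y).trans (mul_le_mul_of_nonneg_right
      ((le_max_left _ _).trans (le_max_left _ _)) (norm_nonneg _))
  refine ⟨max (max L B) 0, le_max_right _ _, hL', fun w y => ?_⟩
  have h1 := hL' w 0 y
  rw [sub_zero] at h1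
  have h2 : B ≤ max (max L B) 0 := (le_max_right _ _).trans (le_max_left _ _)
  calc ‖H w y‖ = ‖(H w y - H 0 y) + H 0 y‖ := by rw [sub_add_cancel]
    _ ≤ ‖H w y - H 0 y‖ + ‖H 0 y‖ := norm_add_le _ _
    _ ≤ max (max L B) 0 * (1 + ‖w‖) := by linarith [hB' y]

theorem exists_isPoissonPair {E 𝒴 : Type*} [NormedAddCommGroup E] [NormedSpace ℝ E]
    [CompleteSpace E] [SecondCountableTopology E] [MeasurableSpace E] [BorelSpace E]
    [MeasurableSpace 𝒴] {P : Kernel 𝒴 𝒴} [IsMarkovKernel P] {d : Measure 𝒴}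
    [IsProbabilityMeasure d] (hmix : GeometricallyMixing P d) {H : E → 𝒴 → E}
    (hH : IsRegularUpdate H) : ∃ V W K, IsPoissonPair P d H V W K := by
  obtain ⟨ϱ, C₀, hϱ, hϱ1, hm₀⟩ := hmix.mixing
  obtain ⟨L, hL, hlip, hbd⟩ := hH.exists_bound
  set C := max C₀ 0
  have hC : 0 ≤ C := le_max_right _ _
  have hm : ∀ (y : 𝒴) (n : ℕ), tvNorm ((P ^ n) y) d ≤ ENNReal.ofReal (C * ϱ ^ n) := fun y n =>
    (hm₀ y n).trans (ENNReal.ofReal_le_ofReal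
      (mul_le_mul_of_nonneg_right (le_max_left _ _) (pow_nonneg hϱ n)))
  set K₀ := C * (1 - ϱ)⁻¹
  have hK₀ : 0 ≤ K₀ := mul_nonneg hC (inv_nonneg.2 (by linarith))
  have hbn : ∀ w : E, 0 ≤ L * (1 + ‖w‖) := fun w => by positivity
  have hmean : ∀ w, ‖meanOp d H w‖ ≤ L * (1 + ‖w‖) := fun w => by
    simpa [meanOp] using norm_integral_le_of_norm_le_const (μ := d) (f := H w)
      (Filter.Eventually.of_forall (hbd w))
  have hmeanlip : ∀ w w', ‖meanOp d H w - meanOp d H w'‖ ≤ L * ‖w - w'‖ := fun w w' => by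
    rw [meanOp, meanOp, ← integral_sub (integrable_of_bounded (hH.measurable w) (hbd w) _)
      (integrable_of_bounded (hH.measurable w') (hbd w') _)]
    simpa using norm_integral_le_of_norm_le_const (μ := d) (f := fun y => H w y - H w' y)
      (Filter.Eventually.of_forall (hlip w w'))
  have hV : ∀ w y, ‖potential P d (H w) y‖ ≤ L * (1 + ‖w‖) * K₀ := fun w y =>
    norm_potential_le hC hϱ hϱ1 hm (hH.measurable w) (hbn w) (hbd w) y
  -- The potential is linear in `g`, so the sup bound applied to `H w - H w'` is a Lipschitz bound
  -- in `w`.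
  have hVlip : ∀ w w' y, ‖potential P d (H w) y - potential P d (H w') y‖ ≤ L * ‖w - w'‖ * K₀ :=
    fun w w' y => by
      rw [← potential_sub hC hϱ hϱ1 hm (hH.measurable w) (hH.measurable w') (hbn w) (hbn w')
        (hbd w) (hbd w')]
      exact norm_potential_le hC hϱ hϱ1 hm ((hH.measurable w).sub (hH.measurable w'))
        (by positivity) (hlip w w') y
  -- `W` is defined through the Poisson equation rather than as an integral, which makes its bounds
  -- immediate; the `2 * L` pays for `H w - h w`.
  refine ⟨fun w => potential P d (H w),
    fun w y => potential P d (H w) y - (H w y - meanOp d H w), L * K₀ + 2 * L, ?_, ?_, ?_, ?_, ?_,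
    ?_, ?_, ?_, ?_⟩
  · positivity
  · exact fun w => measurable_potential hC hϱ hϱ1 hm (hH.measurable w) (hbn w) (hbd w)
  · exact fun w => (measurable_potential hC hϱ hϱ1 hm (hH.measurable w) (hbn w) (hbd w)).sub
      ((hH.measurable w).sub_const _)
  · intro w y
    have := hbn w
    linarith [hV w y]
  · intro w y
    have h1 := norm_sub_le (potential P d (H w) y) (H w y - meanOp d H w)
    have h2 := norm_sub_le (H w y) (meanOp d H w)
    linarith [hV w y, hmean w, hbd w y]
  · intro w w' y
    have : 0 ≤ L * ‖w - w'‖ := by positivity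
    linarith [hVlip w w' y]
  · intro w w' y
    have e : potential P d (H w) y - (H w y - meanOp d H w) -
        (potential P d (H w') y - (H w' y - meanOp d H w')) =
        (potential P d (H w) y - potential P d (H w') y) -
          ((H w y - H w' y) - (meanOp d H w - meanOp d H w')) := by abel
    have h1 := norm_sub_le (potential P d (H w) y - potential P d (H w') y)
      ((H w y - H w' y) - (meanOp d H w - meanOp d H w'))
    have h2 := norm_sub_le (H w y - H w' y) (meanOp d H w - meanOp d H w')
    simp only [e]
    linarith [hVlip w w' y, hmeanlip w w', hlip w w' y]
  · intro w y
    simp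
  · exact fun w y => integral_potential hC hϱ hϱ1 hm (hH.measurable w) (hbn w) (hbd w) y

/-! ### Conditioning on the past of the chain, and one Hoeffding step -/

section Markov

variable {𝒴 Ω : Type*} [MeasurableSpace 𝒴] {mΩ : MeasurableSpace Ω} {μ : Measure Ω}
  [IsProbabilityMeasure μ] {ℱ : Filtration ℕ mΩ} {P : Kernel 𝒴 𝒴} [IsMarkovKernel P]
  {Y : ℕ → Ω → 𝒴}

theorem IsMarkovChain.measurable (hY : IsMarkovChain μ ℱ P Y) {n : ℕ} (hn : 1 ≤ n) :
    Measurable (Y n) :=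
  (hY.adapted n hn).mono (ℱ.le n) le_rfl

/-- The Markov property as a joint law, checked on rectangles. `Z` is any past information from
which the present state can be read off by `Φ`. -/
theorem IsMarkovChain.map_prodMk_eq_compProd (hY : IsMarkovChain μ ℱ P Y) {n : ℕ} (hn : 1 ≤ n)
    {𝒵 : Type*} [MeasurableSpace 𝒵] {Z : Ω → 𝒵} (hZ : Measurable[ℱ n] Z) {Φ : 𝒵 → 𝒴}
    (hΦ : Measurable Φ) (hZY : ∀ ω, Φ (Z ω) = Y n ω) :
    μ.map (fun ω => (Z ω, Y (n + 1) ω)) = (μ.map Z) ⊗ₘ (P.comap Φ hΦ) := by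
  have hZm : Measurable Z := hZ.mono (ℱ.le n) le_rfl
  have hYm : Measurable (Y (n + 1)) := hY.measurable (by omega)
  have hpm : Measurable (fun ω => (Z ω, Y (n + 1) ω)) := hZm.prodMk hYm
  have : IsFiniteMeasure (μ.map Z) := Measure.isFiniteMeasure_map μ Z
  have : IsFiniteMeasure (μ.map (fun ω => (Z ω, Y (n + 1) ω))) := Measure.isFiniteMeasure_map μ _
  refine Measure.ext_prod fun {s t} hs ht => ?_
  rw [Measure.map_apply hpm (hs.prod ht), Measure.compProd_apply_prod hs ht,
    setLIntegral_map hs (Kernel.measurable_coe _ ht) hZm]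
  simp only [Kernel.comap_apply, hZY]
  have hmeas : Measurable fun ω => P (Y n ω) t :=
    (Kernel.measurable_coe P ht).comp (hY.measurable hn)
  have hind : Integrable ((Y (n + 1) ⁻¹' t).indicator fun _ => (1 : ℝ)) μ :=
    (integrable_const _).indicator (hYm ht)
  have h1 := setIntegral_condExp (ℱ.le n) hind (hZ hs)
  rw [setIntegral_congr_ae (g := fun ω => (P (Y n ω)).real t) (hZm hs)
    ((hY.markov n hn t ht).mono fun ω hω _ => hω),
    integral_indicator (hYm ht), integral_const, smul_eq_mul, mul_one] at h1
  simp only [Measure.real] at h1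
  rw [integral_toReal hmeas.aemeasurable
    (Filter.Eventually.of_forall fun ω => measure_lt_top _ _), Measure.restrict_apply .univ,
    Set.univ_inter, Measure.restrict_apply (hYm ht),
    ENNReal.toReal_eq_toReal_iff' ?_ (measure_ne_top _ _)] at h1
  · rw [h1]
    congr 1
    ext ω
    simp [and_comm]
  · refine ((lintegral_mono (g := fun _ => 1) fun ω => prob_le_one).trans_lt ?_).ne
    simp

theorem IsMarkovChain.integral_mul_eq (hY : IsMarkovChain μ ℱ P Y) {n : ℕ} (hn : 1 ≤ n)
    {𝒳 : Type*} [MeasurableSpace 𝒳] {X : Ω → 𝒳} (hX : Measurable[ℱ n] X) {G : Ω → ℝ}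
    (hG : Measurable[ℱ n] G) {φ : 𝒳 → 𝒴 → ℝ} (hφ : Measurable (Function.uncurry φ))
    (hint : Integrable (fun ω => G ω * φ (X ω) (Y (n + 1) ω)) μ) :
    ∫ ω, G ω * φ (X ω) (Y (n + 1) ω) ∂μ = ∫ ω, G ω * ∫ y, φ (X ω) y ∂(P (Y n ω)) ∂μ := by
  have hZ : Measurable[ℱ n] fun ω => (X ω, Y n ω, G ω) := hX.prodMk ((hY.adapted n hn).prodMk hG)
  have hZm : Measurable fun ω => (X ω, Y n ω, G ω) := hZ.mono (ℱ.le n) le_rfl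
  have hYm : Measurable (Y (n + 1)) := hY.measurable (by omega)
  have hΦ : Measurable fun z : 𝒳 × 𝒴 × ℝ => z.2.1 := by fun_prop
  have heq := hY.map_prodMk_eq_compProd hn hZ hΦ fun _ => rfl
  set F : (𝒳 × 𝒴 × ℝ) × 𝒴 → ℝ := fun q => q.1.2.2 * φ q.1.1 q.2 with hF
  have hFm : Measurable F := by
    refine Measurable.mul (by fun_prop) ?_
    exact hφ.comp (g := Function.uncurry φ) (f := fun q : (𝒳 × 𝒴 × ℝ) × 𝒴 => (q.1.1, q.2))
      (by fun_prop)
  have hpm : Measurable fun ω => ((X ω, Y n ω, G ω), Y (n + 1) ω) := hZm.prodMk hYm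
  have : IsFiniteMeasure (μ.map fun ω => (X ω, Y n ω, G ω)) := Measure.isFiniteMeasure_map μ _
  have hFint : Integrable F ((μ.map fun ω => (X ω, Y n ω, G ω)) ⊗ₘ (P.comap _ hΦ)) := by
    rw [← heq, integrable_map_measure hFm.aestronglyMeasurable hpm.aemeasurable]
    exact hint
  have h1 : ∫ ω, G ω * φ (X ω) (Y (n + 1) ω) ∂μ
      = ∫ q, F q ∂(μ.map fun ω => ((X ω, Y n ω, G ω), Y (n + 1) ω)) :=
    (integral_map hpm.aemeasurable hFm.aestronglyMeasurable).symm
  rw [h1, heq, Measure.integral_compProd hFint, integral_map hZm.aemeasurable]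
  · simp only [hF, Kernel.comap_apply, integral_const_mul]
  · exact (hFm.stronglyMeasurable.integral_kernel_prod_right' (κ := P.comap _ hΦ)).aestronglyMeasurable

/-- On `[-c, c]` convexity puts `exp` below its chord `cosh c + (x / c) sinh c`. The conditional
mean zero kills the linear term, and `cosh c ≤ exp (c ^ 2 / 2)`. -/
theorem IsMarkovChain.integral_exp_add_le (hY : IsMarkovChain μ ℱ P Y) {n : ℕ} (hn : 1 ≤ n)
    {𝒳 : Type*} [MeasurableSpace 𝒳] {X : Ω → 𝒳} (hX : Measurable[ℱ n] X) {S : Ω → ℝ}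
    (hS : Measurable[ℱ n] S) (hSint : Integrable (fun ω => Real.exp (S ω)) μ) {φ : 𝒳 → 𝒴 → ℝ}
    (hφ : Measurable (Function.uncurry φ)) (hφ0 : ∀ ω, ∫ y, φ (X ω) y ∂(P (Y n ω)) = 0)
    {c : ℝ} (hc : ∀ᵐ ω ∂μ, |φ (X ω) (Y (n + 1) ω)| ≤ c) (hc0 : 0 ≤ c) :
    Integrable (fun ω => Real.exp (S ω + φ (X ω) (Y (n + 1) ω))) μ ∧
    ∫ ω, Real.exp (S ω + φ (X ω) (Y (n + 1) ω)) ∂μ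
      ≤ Real.exp (c ^ 2 / 2) * ∫ ω, Real.exp (S ω) ∂μ := by
  have hSm : Measurable S := hS.mono (ℱ.le n) le_rfl
  have hDm : Measurable fun ω => φ (X ω) (Y (n + 1) ω) :=
    hφ.comp ((hX.mono (ℱ.le n) le_rfl).prodMk (hY.measurable (by omega)))
  have hprod : Integrable (fun ω => Real.exp (S ω) * φ (X ω) (Y (n + 1) ω)) μ :=
    hSint.mul_bdd hDm.aestronglyMeasurable hc
  have hzero : ∫ ω, Real.exp (S ω) * φ (X ω) (Y (n + 1) ω) ∂μ = 0 := by
    rw [hY.integral_mul_eq hn hX (G := fun ω => Real.exp (S ω)) (Real.measurable_exp.comp hS) hφ hprod]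
    simp [hφ0]
  have hle : ∀ᵐ ω ∂μ, Real.exp (S ω + φ (X ω) (Y (n + 1) ω)) ≤
      Real.cosh c * Real.exp (S ω) +
        Real.sinh c / c * (Real.exp (S ω) * φ (X ω) (Y (n + 1) ω)) := by
    filter_upwards [hc] with ω hω
    set x := φ (X ω) (Y (n + 1) ω)
    -- If `c = 0` then `x = 0`, so the identity survives division by zero.
    have hx : x / c * c = x := by
      rcases hc0.eq_or_lt with h | h
      · rw [← h] at hω ⊢
        simpa using (abs_nonpos_iff.1 hω).symm
      · field_simp
    have h1 : |x / c| ≤ 1 := by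
      rw [abs_div, abs_of_nonneg hc0]
      exact div_le_one_of_le₀ hω hc0
    have h2 := Real.exp_mul_le_cosh_add_mul_sinh h1 c
    rw [hx] at h2
    rw [Real.exp_add]
    calc Real.exp (S ω) * Real.exp x
        ≤ Real.exp (S ω) * (Real.cosh c + x / c * Real.sinh c) :=
          mul_le_mul_of_nonneg_left h2 (Real.exp_pos _).le
      _ = _ := by ring
  have hbint : Integrable (fun ω => Real.cosh c * Real.exp (S ω) +
        Real.sinh c / c * (Real.exp (S ω) * φ (X ω) (Y (n + 1) ω))) μ :=
    (hSint.const_mul _).add (hprod.const_mul _)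
  have hint : Integrable (fun ω => Real.exp (S ω + φ (X ω) (Y (n + 1) ω))) μ := by
    refine hbint.mono' (Real.measurable_exp.comp (hSm.add hDm)).aestronglyMeasurable ?_
    filter_upwards [hle] with ω hω
    rwa [Real.norm_eq_abs, abs_of_pos (Real.exp_pos _)]
  refine ⟨hint, (integral_mono_ae hint hbint hle).trans ?_⟩
  rw [integral_add (hSint.const_mul _) (hprod.const_mul _), integral_const_mul, integral_const_mul,
    hzero, mul_zero, add_zero]
  exact mul_le_mul_of_nonneg_right (Real.cosh_le_exp_half_sq c)
    (integral_nonneg fun _ => (Real.exp_pos _).le)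

end Markov

/-! ### Exponential moments of the weighted martingale -/

section Martingale

variable {E 𝒴 Ω : Type*} [NormedAddCommGroup E] [NormedSpace ℝ E] [FiniteDimensional ℝ E]
  [MeasurableSpace E] [BorelSpace E] [MeasurableSpace 𝒴] {mΩ : MeasurableSpace Ω} {μ : Measure Ω}
  [IsProbabilityMeasure μ] {ℱ : Filtration ℕ mΩ} {P : Kernel 𝒴 𝒴} [IsMarkovKernel P]
  {Y : ℕ → Ω → 𝒴} {d : Measure 𝒴} {H V W : E → 𝒴 → E} {K : ℝ} {w : ℕ → Ω → E} {t₀ : ℕ}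

/-- The martingale difference at time `t + 1` of the Poisson decomposition. -/
def increment (V W : E → 𝒴 → E) (Y : ℕ → Ω → 𝒴) (w : ℕ → Ω → E) (t : ℕ) (ω : Ω) : E :=
  V (w t ω) (Y (t + 1) ω) - W (w t ω) (Y t ω)

/-- The weighted sum of the first `n` martingale differences after time `t₀`. -/
noncomputable def weightedSum (V W : E → 𝒴 → E) (Y : ℕ → Ω → 𝒴) (w : ℕ → Ω → E) (γ : ℕ → ℝ)
    (t₀ n : ℕ) (ω : Ω) : E :=
  ∑ i ∈ Finset.range n, γ i • increment V W Y w (t₀ + i) ω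

theorem continuous_of_norm_sub_le {f : E → E} {K : ℝ}
    (h : ∀ w w', ‖f w - f w'‖ ≤ K * ‖w - w'‖) : Continuous f :=
  (LipschitzWith.of_dist_le_mul (K := K.toNNReal) fun w w' => by
    rw [dist_eq_norm, dist_eq_norm]
    exact (h w w').trans (mul_le_mul_of_nonneg_right (Real.le_coe_toNNReal K)
      (norm_nonneg _))).continuous

theorem measurable_uncurry_of_lipschitz {f : E → 𝒴 → E} {K : ℝ} (hf : ∀ w, Measurable (f w))
    (h : ∀ w w' y, ‖f w y - f w' y‖ ≤ K * ‖w - w'‖) : Measurable (Function.uncurry f) :=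
  measurable_uncurry_of_continuous_of_measurable
    (fun y => continuous_of_norm_sub_le fun w w' => h w w' y) hf

theorem measurable_increment (hY : IsMarkovChain μ ℱ P Y) (hVW : IsPoissonPair P d H V W K)
    (hw : ∀ n, Measurable[ℱ n] (w n)) {n : ℕ} (hn : 1 ≤ n) :
    Measurable[ℱ (n + 1)] (increment V W Y w n) := by
  have h1 := measurable_uncurry_of_lipschitz hVW.measurable_left hVW.lipschitz_left
  have h2 := measurable_uncurry_of_lipschitz hVW.measurable_right hVW.lipschitz_right
  have hwn : Measurable[ℱ (n + 1)] (w n) := (hw n).mono (ℱ.mono n.le_succ) le_rfl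
  have hYn : Measurable[ℱ (n + 1)] (Y n) := (hY.adapted n hn).mono (ℱ.mono n.le_succ) le_rfl
  exact (h1.comp (hwn.prodMk (hY.adapted (n + 1) (by omega)))).sub (h2.comp (hwn.prodMk hYn))

theorem measurable_weightedSum (hY : IsMarkovChain μ ℱ P Y) (hVW : IsPoissonPair P d H V W K)
    (hw : ∀ n, Measurable[ℱ n] (w n)) (ht₀ : 1 ≤ t₀) (γ : ℕ → ℝ) (n : ℕ) :
    Measurable[ℱ (t₀ + n)] (weightedSum V W Y w γ t₀ n) := by
  refine Finset.measurable_fun_sum _ fun i hi => Measurable.const_smul ?_ (γ i)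
  have := Finset.mem_range.1 hi
  exact (measurable_increment hY hVW hw (by omega)).mono (ℱ.mono (by omega)) le_rfl

/-- Azuma–Hoeffding for one linear functional: the increments are centred because `W w = P (V w)`.
The condition `1 ≤ t₀` is there because nothing is known about `Y 0`. -/
theorem integral_exp_weightedSum_le (hY : IsMarkovChain μ ℱ P Y)
    (hVW : IsPoissonPair P d H V W K) (hw : ∀ n, Measurable[ℱ n] (w n)) (ht₀ : 1 ≤ t₀)
    {γ r : ℕ → ℝ} (hr : ∀ᵐ ω ∂μ, ∀ i, ‖γ i • increment V W Y w (t₀ + i) ω‖ ≤ r i)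
    (hr0 : ∀ i, 0 ≤ r i) (f : E →L[ℝ] ℝ) (n : ℕ) :
    Integrable (fun ω => Real.exp (f (weightedSum V W Y w γ t₀ n ω))) μ ∧
    ∫ ω, Real.exp (f (weightedSum V W Y w γ t₀ n ω)) ∂μ
      ≤ Real.exp (‖f‖ ^ 2 / 2 * ∑ i ∈ Finset.range n, r i ^ 2) := by
  induction n with
  | zero => simp [weightedSum]
  | succ n ih =>
    have h1 := measurable_uncurry_of_lipschitz hVW.measurable_left hVW.lipschitz_left
    have h2 := measurable_uncurry_of_lipschitz hVW.measurable_right hVW.lipschitz_right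
    have key := hY.integral_exp_add_le (n := t₀ + n) (by omega)
      (X := fun ω => (w (t₀ + n) ω, Y (t₀ + n) ω))
      ((hw (t₀ + n)).prodMk (hY.adapted (t₀ + n) (by omega)))
      (f.measurable.comp (measurable_weightedSum hY hVW hw ht₀ γ n)) ih.1
      (φ := fun x y => f (γ n • (V x.1 y - W x.1 x.2))) ?_ ?_ (c := ‖f‖ * r n) ?_
      (mul_nonneg (norm_nonneg _) (hr0 n))
    · have e : ∀ ω, f (weightedSum V W Y w γ t₀ (n + 1) ω) = f (weightedSum V W Y w γ t₀ n ω) +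
          f (γ n • (V (w (t₀ + n) ω) (Y (t₀ + n + 1) ω) - W (w (t₀ + n) ω) (Y (t₀ + n) ω))) :=
        fun ω => by
          rw [← map_add, weightedSum, Finset.sum_range_succ]; rfl
      simp only [e]
      refine ⟨key.1, key.2.trans ?_⟩
      calc Real.exp ((‖f‖ * r n) ^ 2 / 2) * ∫ ω, Real.exp (f (weightedSum V W Y w γ t₀ n ω)) ∂μ
          ≤ Real.exp ((‖f‖ * r n) ^ 2 / 2) *
            Real.exp (‖f‖ ^ 2 / 2 * ∑ i ∈ Finset.range n, r i ^ 2) :=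
            mul_le_mul_of_nonneg_left ih.2 (Real.exp_pos _).le
        _ = _ := by
            rw [← Real.exp_add, Finset.sum_range_succ]
            ring_nf
    · refine f.measurable.comp (Measurable.const_smul (Measurable.sub ?_ ?_) _)
      · exact h1.comp (f := fun q : (E × 𝒴) × 𝒴 => (q.1.1, q.2)) (by fun_prop)
      · exact h2.comp (f := fun q : (E × 𝒴) × 𝒴 => (q.1.1, q.1.2)) (by fun_prop)
    · intro ω
      have hV : Integrable (V (w (t₀ + n) ω)) (P (Y (t₀ + n) ω)) :=
        integrable_of_bounded (hVW.measurable_left _) (hVW.bound_left _) _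
      have hi := hV.sub (integrable_const (W (w (t₀ + n) ω) (Y (t₀ + n) ω)))
      have := (f.comp (γ n • ContinuousLinearMap.id ℝ E)).integral_comp_comm hi
      simp only [ContinuousLinearMap.comp_apply, smul_apply,
        ContinuousLinearMap.id_apply, Pi.sub_apply] at this
      rw [this, integral_sub hV (integrable_const _), hVW.integral_eq]
      simp
    · filter_upwards [hr] with ω hω
      exact (f.le_opNorm _).trans (mul_le_mul_of_nonneg_left (hω n) (norm_nonneg _))

end Martingale

/-! ### Concentration uniformly in time -/

section Concentration

variable {E 𝒴 Ω : Type*} [NormedAddCommGroup E] [NormedSpace ℝ E] [FiniteDimensional ℝ E]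
  [MeasurableSpace E] [BorelSpace E] [MeasurableSpace 𝒴] {mΩ : MeasurableSpace Ω} {μ : Measure Ω}
  [IsProbabilityMeasure μ] {ℱ : Filtration ℕ mΩ} {P : Kernel 𝒴 𝒴} [IsMarkovKernel P]
  {Y : ℕ → Ω → 𝒴} {d : Measure 𝒴} {H V W : E → 𝒴 → E} {K : ℝ} {w : ℕ → Ω → E} {t₀ : ℕ}

theorem summable_inv_add_one_sq : Summable fun n : ℕ => (((n : ℝ) + 1) ^ 2)⁻¹ := by
  have := (summable_nat_add_iff (f := fun n : ℕ => ((n : ℝ) ^ 2)⁻¹) 1).2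
    (Real.summable_nat_pow_inv.2 one_lt_two)
  simpa using this

/-- A single Markov inequality for `∑ exp (X n) / (n + 1) ^ 2` handles all `n` at once; the weights
are the source of `2 log (n + 1)`. -/
theorem exists_union_tail_of_exp_moment {X : ℕ → Ω → ℝ} (hX : ∀ n, Measurable (X n)) {A : ℝ}
    (hint : ∀ n, Integrable (fun ω => Real.exp (X n ω)) μ)
    (hA : ∀ n, ∫ ω, Real.exp (X n ω) ∂μ ≤ A) :
    ∃ B : ℝ, 1 ≤ B ∧ ∀ δ : ℝ, 0 < δ →
      μ {ω | ∃ n : ℕ, Real.log (1 / δ) + Real.log B + 2 * Real.log ((n : ℝ) + 1) < X n ω}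
        ≤ ENNReal.ofReal δ := by
  have hA0 : 0 ≤ A := (integral_nonneg fun _ => (Real.exp_pos _).le).trans (hA 0)
  set s := ∑' n : ℕ, (((n : ℝ) + 1) ^ 2)⁻¹
  set B := max (A * s) 1
  have hB1 : 1 ≤ B := le_max_right _ _
  refine ⟨B, hB1, fun δ hδ => ?_⟩
  set Z : Ω → ENNReal := fun ω => ∑' n : ℕ,
    ENNReal.ofReal ((((n : ℝ) + 1) ^ 2)⁻¹ * Real.exp (X n ω))
  have hm : ∀ n : ℕ, Measurable fun ω =>
      ENNReal.ofReal ((((n : ℝ) + 1) ^ 2)⁻¹ * Real.exp (X n ω)) := fun n =>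
    ((Real.measurable_exp.comp (hX n)).const_mul _).ennreal_ofReal
  have hZm : Measurable Z := Measurable.tsum hm
  have hZ : ∫⁻ ω, Z ω ∂μ ≤ ENNReal.ofReal B := by
    rw [lintegral_tsum fun n => (hm n).aemeasurable]
    calc ∑' n : ℕ, ∫⁻ ω, ENNReal.ofReal ((((n : ℝ) + 1) ^ 2)⁻¹ * Real.exp (X n ω)) ∂μ
        ≤ ∑' n : ℕ, ENNReal.ofReal (A * (((n : ℝ) + 1) ^ 2)⁻¹) := by
          refine ENNReal.tsum_le_tsum fun n => ?_
          rw [← ofReal_integral_eq_lintegral_ofReal ((hint n).const_mul _)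
            (Filter.Eventually.of_forall fun ω => by positivity), integral_const_mul, mul_comm]
          exact ENNReal.ofReal_le_ofReal (mul_le_mul_of_nonneg_right (hA n) (by positivity))
      _ = ENNReal.ofReal (A * s) := by
          rw [← ENNReal.ofReal_tsum_of_nonneg (fun n => by positivity)
            (summable_inv_add_one_sq.mul_left A), tsum_mul_left]
      _ ≤ ENNReal.ofReal B := ENNReal.ofReal_le_ofReal (le_max_left _ _)
  have hB0 : 0 < B := by linarith
  have hmarkov := mul_meas_ge_le_lintegral (μ := μ) hZm (ENNReal.ofReal (B / δ))
  have hsub : {ω | ∃ n : ℕ, Real.log (1 / δ) + Real.log B + 2 * Real.log ((n : ℝ) + 1) < X n ω} ⊆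
      {ω | ENNReal.ofReal (B / δ) ≤ Z ω} := by
    rintro ω ⟨n, hn⟩
    refine le_trans ?_ (ENNReal.le_tsum n)
    refine ENNReal.ofReal_le_ofReal ?_
    have hn1 : (0 : ℝ) < (n : ℝ) + 1 := by positivity
    have h1 := (Real.exp_lt_exp.2 hn).le
    rw [Real.exp_add, Real.exp_add, Real.exp_log (by positivity), Real.exp_log hB0, two_mul,
      Real.exp_add, Real.exp_log hn1] at h1
    rw [inv_mul_eq_div, le_div_iff₀ (by positivity)]
    calc B / δ * ((n : ℝ) + 1) ^ 2 = 1 / δ * B * (((n : ℝ) + 1) * ((n : ℝ) + 1)) := by ring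
      _ ≤ _ := h1
  refine (measure_mono hsub).trans ?_
  have h3 : ENNReal.ofReal (B / δ) * μ {ω | ENNReal.ofReal (B / δ) ≤ Z ω} ≤
      ENNReal.ofReal (B / δ) * ENNReal.ofReal δ := by
    rw [← ENNReal.ofReal_mul (by positivity), div_mul_cancel₀ _ hδ.ne']
    exact hmarkov.trans hZ
  exact (ENNReal.mul_le_mul_iff_right (ENNReal.ofReal_pos.2 (by positivity)).ne'
    ENNReal.ofReal_ne_top).1 h3

/-- The coordinates of a basis: finitely many one-sided scalar bounds control the norm. -/
theorem exists_finite_dual_bound (E : Type*) [NormedAddCommGroup E] [NormedSpace ℝ E]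
    [FiniteDimensional ℝ E] : ∃ (m : ℕ) (f : Fin m → E →L[ℝ] ℝ) (c : ℝ), 0 ≤ c ∧
      ∀ (v : E) (x : ℝ), (∀ i, f i v ≤ x) → (∀ i, -f i v ≤ x) → ‖v‖ ≤ c * x := by
  set b := Module.finBasis ℝ E
  refine ⟨_, fun i => LinearMap.toContinuousLinearMap (b.coord i), ∑ i, ‖b i‖,
    Finset.sum_nonneg fun _ _ => norm_nonneg _, fun v x h1 h2 => ?_⟩
  calc ‖v‖ = ‖∑ i, b.repr v i • b i‖ := by rw [b.sum_repr]
    _ ≤ ∑ i, ‖b.repr v i • b i‖ := norm_sum_le _ _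
    _ ≤ ∑ i, ‖b i‖ * x := by
        refine Finset.sum_le_sum fun i _ => ?_
        rw [norm_smul, mul_comm]
        refine mul_le_mul_of_nonneg_left (abs_le.2 ⟨?_, h1 i⟩) (norm_nonneg _)
        have := h2 i
        simp only [LinearMap.coe_toContinuousLinearMap', Module.Basis.coord_apply] at this
        linarith
    _ = (∑ i, ‖b i‖) * x := by rw [Finset.sum_mul]

theorem exists_weightedSum_tail (hY : IsMarkovChain μ ℱ P Y)
    (hVW : IsPoissonPair P d H V W K) (hw : ∀ n, Measurable[ℱ n] (w n)) (ht₀ : 1 ≤ t₀)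
    {γ r : ℕ → ℝ} (hr : ∀ᵐ ω ∂μ, ∀ i, ‖γ i • increment V W Y w (t₀ + i) ω‖ ≤ r i)
    (hr0 : ∀ i, 0 ≤ r i) (hrs : Summable fun i => r i ^ 2) :
    ∃ c : ℝ, 1 ≤ c ∧ ∀ δ : ℝ, 0 < δ → δ < 1 → ENNReal.ofReal (1 - δ) ≤
      μ {ω | ∀ n : ℕ, ‖weightedSum V W Y w γ t₀ n ω‖ ≤
        c * (Real.log (1 / δ) + c + 2 * Real.log ((n : ℝ) + 1))} := by
  obtain ⟨m, f, c, hc, hfc⟩ := exists_finite_dual_bound E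
  have hSm : ∀ n, Measurable (weightedSum V W Y w γ t₀ n) := fun n =>
    (measurable_weightedSum hY hVW hw ht₀ γ n).mono (ℱ.le _) le_rfl
  have hB : ∀ g : E →L[ℝ] ℝ, ∃ B : ℝ, 1 ≤ B ∧ ∀ δ : ℝ, 0 < δ →
      μ {ω | ∃ n : ℕ, Real.log (1 / δ) + Real.log B + 2 * Real.log ((n : ℝ) + 1) <
        g (weightedSum V W Y w γ t₀ n ω)} ≤ ENNReal.ofReal δ := fun g => by
    refine exists_union_tail_of_exp_moment (A := Real.exp (‖g‖ ^ 2 / 2 * ∑' i, r i ^ 2))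
      (fun n => g.measurable.comp (hSm n))
      (fun n => (integral_exp_weightedSum_le hY hVW hw ht₀ hr hr0 g n).1)
      (fun n => (integral_exp_weightedSum_le hY hVW hw ht₀ hr hr0 g n).2.trans ?_)
    refine Real.exp_le_exp.2 (mul_le_mul_of_nonneg_left ?_ (by positivity))
    exact hrs.sum_le_tsum _ fun i _ => sq_nonneg _
  choose B hB1 hB2 using hB
  set L : ℝ := Real.log (2 * m + 1) + ∑ i, Real.log (B (f i)) + ∑ i, Real.log (B (-f i))
  have hlB : ∀ g, 0 ≤ Real.log (B g) := fun g => Real.log_nonneg (hB1 g)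
  have hLm : 0 ≤ Real.log (2 * m + 1 : ℝ) :=
    Real.log_nonneg (by have : (0 : ℝ) ≤ m := Nat.cast_nonneg m; linarith)
  have hS1 : 0 ≤ ∑ i, Real.log (B (f i)) := Finset.sum_nonneg fun i _ => hlB _
  have hS2 : 0 ≤ ∑ i, Real.log (B (-f i)) := Finset.sum_nonneg fun i _ => hlB _
  have hL1 : ∀ i, Real.log (2 * m + 1) + Real.log (B (f i)) ≤ L := fun i => by
    have := Finset.single_le_sum (f := fun i => Real.log (B (f i))) (fun i _ => hlB _)
      (Finset.mem_univ i)
    simp only [L]; linarith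
  have hL2 : ∀ i, Real.log (2 * m + 1) + Real.log (B (-f i)) ≤ L := fun i => by
    have := Finset.single_le_sum (f := fun i => Real.log (B (-f i))) (fun i _ => hlB _)
      (Finset.mem_univ i)
    simp only [L]; linarith
  have hL0 : 0 ≤ L := by positivity
  refine ⟨c + L + 1, by linarith, fun δ hδ hδ1 => ?_⟩
  have hm0 : (0 : ℝ) < 2 * m + 1 := by positivity
  -- There are `2 * m` one-sided events; the extra `1` keeps the denominator positive when `m = 0`.
  set ε : ℝ := δ / (2 * m + 1) with hε
  have hε0 : 0 < ε := by positivity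
  have hlogε : Real.log (1 / ε) = Real.log (1 / δ) + Real.log (2 * m + 1) := by
    rw [hε, one_div_div, Real.log_div hm0.ne' hδ.ne', one_div, Real.log_inv]; ring
  set bad : (E →L[ℝ] ℝ) → Set Ω := fun g =>
    {ω | ∃ n : ℕ, Real.log (1 / ε) + Real.log (B g) + 2 * Real.log ((n : ℝ) + 1) <
        g (weightedSum V W Y w γ t₀ n ω)} with hbad
  set G : Set Ω := {ω | ∀ n : ℕ, ‖weightedSum V W Y w γ t₀ n ω‖ ≤
        (c + L + 1) * (Real.log (1 / δ) + (c + L + 1) + 2 * Real.log ((n : ℝ) + 1))}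
  have hlδ : 0 ≤ Real.log (1 / δ) := Real.log_nonneg (by rw [le_div_iff₀ hδ]; linarith)
  have hcompl : Gᶜ ⊆ (⋃ i, bad (f i)) ∪ ⋃ i, bad (-f i) := by
    intro ω hω
    by_contra hcon
    simp only [Set.mem_union, Set.mem_iUnion, not_or, not_exists, hbad, Set.mem_ofPred_eq,
      not_lt, neg_apply] at hcon
    refine hω fun n => ?_
    have hln : 0 ≤ Real.log ((n : ℝ) + 1) :=
      Real.log_nonneg (by have : (0 : ℝ) ≤ n := Nat.cast_nonneg n; linarith)
    have h := hfc (weightedSum V W Y w γ t₀ n ω)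
      (Real.log (1 / δ) + L + 2 * Real.log ((n : ℝ) + 1))
      (fun i => (hcon.1 i n).trans (by rw [hlogε]; linarith [hL1 i]))
      (fun i => (hcon.2 i n).trans (by rw [hlogε]; linarith [hL2 i]))
    refine h.trans (mul_le_mul (by linarith) (by linarith) (by positivity) (by positivity))
  have hGc : μ Gᶜ ≤ ENNReal.ofReal δ := by
    have hsum : ∀ g : Fin m → E →L[ℝ] ℝ, μ (⋃ i, bad (g i)) ≤ ENNReal.ofReal (m * ε) := fun g => by
      refine (measure_iUnion_fintype_le μ _).trans ((Finset.sum_le_sum fun i _ =>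
        hB2 (g i) ε hε0).trans ?_)
      rw [Finset.sum_const, Finset.card_univ, Fintype.card_fin, nsmul_eq_mul,
        ENNReal.ofReal_mul (Nat.cast_nonneg m), ENNReal.ofReal_natCast]
    calc μ Gᶜ ≤ μ ((⋃ i, bad (f i)) ∪ ⋃ i, bad (-f i)) := measure_mono hcompl
      _ ≤ ENNReal.ofReal (m * ε) + ENNReal.ofReal (m * ε) :=
          (measure_union_le _ _).trans (add_le_add (hsum f) (hsum fun i => -f i))
      _ = ENNReal.ofReal (m * ε + m * ε) := (ENNReal.ofReal_add (by positivity) (by positivity)).symm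
      _ ≤ ENNReal.ofReal δ := by
          refine ENNReal.ofReal_le_ofReal ?_
          have : δ = (2 * m + 1) * ε := by rw [hε]; field_simp
          linarith
  have h1 : 1 ≤ μ G + μ Gᶜ := by
    rw [← measure_univ (μ := μ), ← Set.union_compl_self G]
    exact measure_union_le _ _
  rw [ENNReal.ofReal_sub _ hδ.le, ENNReal.ofReal_one, tsub_le_iff_right]
  exact h1.trans (add_le_add_right hGc _)

end Concentration

/-! ### Deterministic recursion and summation by parts -/

section Deterministic

variable {E : Type*} [NormedAddCommGroup E] [NormedSpace ℝ E]

/-- The product `∏_{j < n} (1 - a j)`. -/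
noncomputable def decay (a : ℕ → ℝ) (n : ℕ) : ℝ := ∏ j ∈ Finset.range n, (1 - a j)

theorem decay_succ (a : ℕ → ℝ) (n : ℕ) : decay a (n + 1) = decay a n * (1 - a n) :=
  Finset.prod_range_succ _ _

theorem decay_pos {a : ℕ → ℝ} (ha : ∀ n, a n < 1) (n : ℕ) : 0 < decay a n :=
  Finset.prod_pos fun j _ => sub_pos.2 (ha j)

theorem decay_le_exp {a : ℕ → ℝ} (ha : ∀ n, a n < 1) (n : ℕ) :
    decay a n ≤ Real.exp (-∑ j ∈ Finset.range n, a j) := by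
  rw [← Finset.sum_neg_distrib, Real.exp_sum]
  exact Finset.prod_le_prod (fun j _ => (sub_pos.2 (ha j)).le)
    fun j _ => Real.one_sub_le_exp_neg (a j)

/-- Factorwise `(1 + 2x)(1 - x) ≥ 1` on `[0, 1/2]`. -/
theorem inv_decay_le_exp {a : ℕ → ℝ} (ha0 : ∀ n, 0 ≤ a n) (ha : ∀ n, a n ≤ 1 / 2) (n : ℕ) :
    (decay a n)⁻¹ ≤ Real.exp (2 * ∑ j ∈ Finset.range n, a j) := by
  rw [Finset.mul_sum, Real.exp_sum, decay, ← Finset.prod_inv_distrib]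
  refine Finset.prod_le_prod (fun j _ => inv_nonneg.2 (by linarith [ha j])) fun j _ => ?_
  rw [inv_le_iff_one_le_mul₀ (by linarith [ha j])]
  have h1 := Real.add_one_le_exp (2 * a j)
  nlinarith [mul_le_mul_of_nonneg_right h1 (show 0 ≤ 1 - a j by linarith [ha j]), ha0 j, ha j]

/-- A perturbed contraction in the relaxed iteration with step sizes `a n` contracts like
`∏ (1 - (1 - κ) a j)`, up to the weighted sums of the perturbation. -/
theorem norm_le_decay_mul {a : ℕ → ℝ} (ha0 : ∀ n, 0 ≤ a n) (ha : ∀ n, a n ≤ 1 / 2) {κ : ℝ}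
    (hκ0 : 0 ≤ κ) (hκ1 : κ < 1) {x g ξ : ℕ → E}
    (hx : ∀ n, x (n + 1) = x n + a n • (g n + ξ n - x n)) (hg : ∀ n, ‖g n‖ ≤ κ * ‖x n‖)
    {U : ℕ → ℝ} (hU : Monotone U)
    (hξ : ∀ n, ‖∑ i ∈ Finset.range n, (a i / decay a (i + 1)) • ξ i‖ ≤ U n) (n : ℕ) :
    ‖x n‖ ≤ decay (fun j => (1 - κ) * a j) n *
      (‖x 0‖ + (1 + 2 * ∑ j ∈ Finset.range n, a j) * U n) := by
  set β := decay a
  set η := decay fun j => (1 - κ) * a j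
  set s : ℕ → E := fun n => ∑ i ∈ Finset.range n, (a i / β (i + 1)) • ξ i
  have hβ : ∀ n, 0 < β n := decay_pos fun n => by linarith [ha n]
  have hθa : ∀ n, (1 - κ) * a n ≤ 1 / 2 := fun n => by nlinarith [ha0 n, ha n]
  have hη : ∀ n, 0 < η n := decay_pos fun n => by linarith [hθa n]
  have hβη : ∀ n, β n ≤ η n := fun n => Finset.prod_le_prod (fun j _ => by linarith [ha j])
    fun j _ => by nlinarith [ha0 j]
  have hU0 : ∀ n, 0 ≤ U n := fun n => (norm_nonneg _).trans (hξ n)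
  -- `β n • s n` solves the recursion `u (n+1) = (1 - a n) u n + a n ξ n` from `0`. After
  -- subtracting it, the noise enters only through the bound on `g n`, of size `κ * β n * U n`.
  have hz : ∀ n, ‖x n - β n • s n‖ ≤
      η n * (‖x 0‖ + 2 * (∑ j ∈ Finset.range n, a j) * U n) := fun n => by
    induction n with
    | zero => simp [β, η, s, decay]
    | succ n ih =>
      have hs : β (n + 1) • s (n + 1) = (1 - a n) • β n • s n + a n • ξ n := by
        have : s (n + 1) = s n + (a n / β (n + 1)) • ξ n := Finset.sum_range_succ _ _
        rw [this, smul_add, smul_smul (β (n + 1)), mul_div_cancel₀ _ (hβ _).ne', smul_smul,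
          show β (n + 1) = β n * (1 - a n) from decay_succ a n, mul_comm (1 - a n)]
      have hzs : x (n + 1) - β (n + 1) • s (n + 1) =
          (1 - a n) • (x n - β n • s n) + a n • g n := by
        rw [hs, hx]
        module
      have hxn : ‖x n‖ ≤ ‖x n - β n • s n‖ + β n * U n := by
        calc ‖x n‖ = ‖(x n - β n • s n) + β n • s n‖ := by rw [sub_add_cancel]
          _ ≤ ‖x n - β n • s n‖ + ‖β n • s n‖ := norm_add_le _ _
          _ ≤ ‖x n - β n • s n‖ + β n * U n := by
              rw [norm_smul, Real.norm_of_nonneg (hβ n).le]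
              exact add_le_add_right (mul_le_mul_of_nonneg_left (hξ n) (hβ n).le) _
      have hUn : U n ≤ U (n + 1) := hU n.le_succ
      have hA : 0 ≤ ∑ j ∈ Finset.range n, a j := Finset.sum_nonneg fun j _ => ha0 j
      -- The new error is made at time `n` but must carry the factor `η (n + 1)`; this costs the
      -- factor `2` in front of the sum of the steps.
      have hη2 : η n ≤ 2 * η (n + 1) := by
        rw [show η (n + 1) = η n * (1 - (1 - κ) * a n) from decay_succ _ n]
        nlinarith [hη n, hθa n]
      calc ‖x (n + 1) - β (n + 1) • s (n + 1)‖
          ≤ ‖(1 - a n) • (x n - β n • s n)‖ + ‖a n • g n‖ := by rw [hzs]; exact norm_add_le _ _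
        _ = (1 - a n) * ‖x n - β n • s n‖ + a n * ‖g n‖ := by
            rw [norm_smul, norm_smul, Real.norm_of_nonneg (by linarith [ha n]),
              Real.norm_of_nonneg (ha0 n)]
        _ ≤ (1 - a n) * ‖x n - β n • s n‖ +
            a n * (κ * (‖x n - β n • s n‖ + β n * U n)) :=
            add_le_add_right (mul_le_mul_of_nonneg_left
              ((hg n).trans (mul_le_mul_of_nonneg_left hxn hκ0)) (ha0 n)) _
        _ = (1 - (1 - κ) * a n) * ‖x n - β n • s n‖ + a n * (κ * (β n * U n)) := by ring
        _ ≤ (1 - (1 - κ) * a n) *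
              (η n * (‖x 0‖ + 2 * (∑ j ∈ Finset.range n, a j) * U n)) +
            a n * (2 * η (n + 1) * U (n + 1)) := by
            refine add_le_add (mul_le_mul_of_nonneg_left ih (by linarith [hθa n]))
              (mul_le_mul_of_nonneg_left ?_ (ha0 n))
            calc κ * (β n * U n) ≤ 1 * (β n * U n) :=
                  mul_le_mul_of_nonneg_right hκ1.le (mul_nonneg (hβ n).le (hU0 n))
              _ = β n * U n := one_mul _
              _ ≤ 2 * η (n + 1) * U (n + 1) :=
                  mul_le_mul ((hβη n).trans hη2) hUn (hU0 n) (by linarith [hη (n + 1)])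
        _ = η (n + 1) * (‖x 0‖ + 2 * (∑ j ∈ Finset.range n, a j) * U n) +
            η (n + 1) * (2 * a n * U (n + 1)) := by
            rw [show η (n + 1) = η n * (1 - (1 - κ) * a n) from decay_succ _ n]; ring
        _ ≤ η (n + 1) * (‖x 0‖ + 2 * (∑ j ∈ Finset.range n, a j) * U (n + 1)) +
            η (n + 1) * (2 * a n * U (n + 1)) := by
            gcongr
            exact (hη _).le
        _ = η (n + 1) * (‖x 0‖ + 2 * (∑ j ∈ Finset.range (n + 1), a j) * U (n + 1)) := by
            rw [Finset.sum_range_succ]; ring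
  calc ‖x n‖ = ‖(x n - β n • s n) + β n • s n‖ := by rw [sub_add_cancel]
    _ ≤ ‖x n - β n • s n‖ + ‖β n • s n‖ := norm_add_le _ _
    _ ≤ η n * (‖x 0‖ + 2 * (∑ j ∈ Finset.range n, a j) * U n) + η n * U n := by
        refine add_le_add (hz n) ?_
        rw [norm_smul, Real.norm_of_nonneg (hβ n).le]
        exact mul_le_mul (hβη n) (hξ n) (norm_nonneg _) (hη n).le
    _ = _ := by ring

theorem sum_smul_sub_succ (γ : ℕ → ℝ) (A : ℕ → E) (n : ℕ) :
    ∑ i ∈ Finset.range n, γ i • (A i - A (i + 1)) = γ 0 • A 0 - γ n • A n +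
      ∑ i ∈ Finset.range n, (γ (i + 1) - γ i) • A (i + 1) := by
  induction n with
  | zero => simp
  | succ n ih =>
    rw [Finset.sum_range_succ, ih, Finset.sum_range_succ]
    module

/-- Control of the step sizes `a`, relative to a growth sequence `G`, by a sequence `s` of order
`n^{1/4}`. -/
structure IsTameStep (a G s : ℕ → ℝ) (c : ℝ) : Prop where
  const_nonneg : 0 ≤ c
  pos : ∀ n, 0 < a n
  le_half : ∀ n, a n ≤ 1 / 2
  antitone : ∀ n, a (n + 1) ≤ a n
  le_div : ∀ n, a n ≤ c / s n ^ 4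
  sub_le_div : ∀ n, a n - a (n + 1) ≤ c / s n ^ 8
  growth_nonneg : ∀ n, 0 ≤ G n
  growth_le : ∀ n, G n / decay a (n + 1) ≤ c * s n
  one_le_scale : ∀ n, 1 ≤ s n
  scale_succ_le : ∀ n, s (n + 1) ≤ 2 * s n
  summable : Summable fun n => 1 / s n ^ 6

namespace IsTameStep

variable {a G s : ℕ → ℝ} {c : ℝ}

theorem decay_pos (h : IsTameStep a G s c) (n : ℕ) : 0 < decay a n :=
  StochApprox.decay_pos (fun n => by linarith [h.le_half n]) n

theorem weight_nonneg (h : IsTameStep a G s c) (n : ℕ) : 0 ≤ a n / decay a (n + 1) :=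
  div_nonneg (h.pos n).le (h.decay_pos _).le

theorem weight_mul_growth_le (h : IsTameStep a G s c) (n : ℕ) :
    a n / decay a (n + 1) * G n ≤ c ^ 2 / s n ^ 3 := by
  have hs : 0 < s n := by linarith [h.one_le_scale n]
  calc a n / decay a (n + 1) * G n = a n * (G n / decay a (n + 1)) := by ring
    _ ≤ c / s n ^ 4 * (c * s n) := mul_le_mul (h.le_div n) (h.growth_le n)
        (div_nonneg (h.growth_nonneg n) (h.decay_pos _).le)
        (div_nonneg h.const_nonneg (by positivity))
    _ = c ^ 2 / s n ^ 3 := by field_simp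

theorem weight_mul_growth_le_const (h : IsTameStep a G s c) (n : ℕ) :
    a n / decay a (n + 1) * G n ≤ c ^ 2 :=
  (h.weight_mul_growth_le n).trans
    (div_le_self (sq_nonneg c) (one_le_pow₀ (h.one_le_scale n)))

/-- With `s n` of order `n^(1/4)`, the weights times the growth are `O(n^(-3/4))`: the variance
proxy of the martingale is finite. -/
theorem summable_weight_sq (h : IsTameStep a G s c) (K : ℝ) :
    Summable fun n => (K * (a n / decay a (n + 1) * G n)) ^ 2 := by
  refine Summable.of_nonneg_of_le (fun n => sq_nonneg _) (fun n => ?_)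
    (h.summable.mul_left (K ^ 2 * c ^ 4))
  have hs : 0 < s n := by linarith [h.one_le_scale n]
  rw [mul_pow, mul_assoc]
  refine mul_le_mul_of_nonneg_left ?_ (sq_nonneg K)
  calc (a n / decay a (n + 1) * G n) ^ 2 ≤ (c ^ 2 / s n ^ 3) ^ 2 :=
        pow_le_pow_left₀ (mul_nonneg (h.weight_nonneg n) (h.growth_nonneg n))
          (h.weight_mul_growth_le n) 2
    _ = c ^ 4 * (1 / s n ^ 6) := by field_simp

/-- Pays for the drift of `w` during one step, which is of order `a n * G n`. -/
theorem weight_mul_step_le (h : IsTameStep a G s c) (n : ℕ) :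
    a n / decay a (n + 1) * (a n * G n) ≤ c ^ 3 * (1 / s n ^ 6) := by
  have hs1 := h.one_le_scale n
  have hs : 0 < s n := by linarith
  calc a n / decay a (n + 1) * (a n * G n) = a n * (a n / decay a (n + 1) * G n) := by ring
    _ ≤ c / s n ^ 4 * (c ^ 2 / s n ^ 3) := mul_le_mul (h.le_div n) (h.weight_mul_growth_le n)
        (mul_nonneg (h.weight_nonneg n) (h.growth_nonneg n))
        (div_nonneg h.const_nonneg (by positivity))
    _ = c ^ 3 * (1 / s n ^ 7) := by field_simp
    _ ≤ c ^ 3 * (1 / s n ^ 6) := by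
        refine mul_le_mul_of_nonneg_left ?_ (pow_nonneg h.const_nonneg 3)
        exact one_div_le_one_div_of_le (by positivity) (pow_le_pow_right₀ hs1 (by norm_num))

/-- The difference of consecutive weights has numerator `a n * a (n+1) - (a n - a (n+1))`, whose two
terms are both `O(n^(-2))`. -/
theorem weight_variation_le (h : IsTameStep a G s c) (n : ℕ) :
    |a (n + 1) / decay a (n + 1 + 1) - a n / decay a (n + 1)| * G (n + 1) ≤
      2 * (c ^ 2 + c ^ 3) * (1 / s n ^ 6) := by
  have hs1 := h.one_le_scale n
  have hs : 0 < s n := by linarith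
  have hc := h.const_nonneg
  have hd := h.decay_pos (n + 1)
  have ha1 : 0 < 1 - a (n + 1) := by linarith [h.le_half (n + 1)]
  have e : a (n + 1) / decay a (n + 1 + 1) - a n / decay a (n + 1) =
      (a n * a (n + 1) - (a n - a (n + 1))) / decay a (n + 1 + 1) := by
    rw [decay_succ a (n + 1)]
    field_simp
    ring
  have hnum : |a n * a (n + 1) - (a n - a (n + 1))| ≤ c ^ 2 / s n ^ 8 + c / s n ^ 8 := by
    have h1 : a n * a (n + 1) ≤ c ^ 2 / s n ^ 8 := by
      calc a n * a (n + 1) ≤ c / s n ^ 4 * (c / s n ^ 4) :=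
            mul_le_mul (h.le_div n) ((h.antitone n).trans (h.le_div n)) (h.pos _).le
              (div_nonneg hc (by positivity))
        _ = c ^ 2 / s n ^ 8 := by field_simp
    have h2 : 0 ≤ a n * a (n + 1) := mul_nonneg (h.pos _).le (h.pos _).le
    have h3 := h.sub_le_div n
    have h4 := h.antitone n
    rw [abs_le]
    constructor <;> linarith [show 0 ≤ c ^ 2 / s n ^ 8 by positivity,
      show 0 ≤ c / s n ^ 8 by positivity]
  rw [e, abs_div, abs_of_pos (h.decay_pos (n + 1 + 1))]
  calc |a n * a (n + 1) - (a n - a (n + 1))| / decay a (n + 1 + 1) * G (n + 1)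
      = |a n * a (n + 1) - (a n - a (n + 1))| * (G (n + 1) / decay a (n + 1 + 1)) := by ring
    _ ≤ (c ^ 2 / s n ^ 8 + c / s n ^ 8) * (c * (2 * s n)) := by
        refine mul_le_mul hnum ((h.growth_le (n + 1)).trans
          (mul_le_mul_of_nonneg_left (h.scale_succ_le n) hc))
          (div_nonneg (h.growth_nonneg _) (h.decay_pos _).le) (by positivity)
    _ = 2 * (c ^ 2 + c ^ 3) * (1 / s n ^ 7) := by field_simp; ring
    _ ≤ 2 * (c ^ 2 + c ^ 3) * (1 / s n ^ 6) := by
        refine mul_le_mul_of_nonneg_left ?_ (by positivity)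
        exact one_div_le_one_div_of_le (by positivity) (pow_le_pow_right₀ hs1 (by norm_num))

/-- For `A i = W (w i) (Y i)` and `A' i = W (w i) (Y (i+1))`: inserting `A (i + 1)` splits the sum
into a telescoping part, summed by parts, and the drift of `w`. `B` is chosen before `A` and `A'`,
hence is deterministic in the application. -/
theorem exists_norm_sum_le (h : IsTameStep a G s c) {K : ℝ} (hK : 0 ≤ K) :
    ∃ B : ℝ, 0 ≤ B ∧ ∀ A A' : ℕ → E, (∀ n, ‖A n‖ ≤ K * G n) →
      (∀ n, ‖A (n + 1) - A' n‖ ≤ K * (a n * G n)) → ∀ n,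
      ‖∑ i ∈ Finset.range n, (a i / decay a (i + 1)) • (A i - A' i)‖ ≤ B := by
  have hc := h.const_nonneg
  have hS : 0 ≤ ∑' n, 1 / s n ^ 6 := tsum_nonneg fun n => by
    have := h.one_le_scale n
    positivity
  refine ⟨K * c ^ 2 + K * c ^ 2 + K * (2 * (c ^ 2 + c ^ 3)) * (∑' n, 1 / s n ^ 6) +
    K * c ^ 3 * ∑' n, 1 / s n ^ 6, by positivity, fun A A' hA hA' n => ?_⟩
  set γ : ℕ → ℝ := fun i => a i / decay a (i + 1) with hγ
  have hpart : ∀ C : ℝ, 0 ≤ C → ∑ i ∈ Finset.range n, C * (1 / s i ^ 6) ≤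
      C * ∑' n, 1 / s n ^ 6 := fun C hC => by
    rw [← Finset.mul_sum]
    refine mul_le_mul_of_nonneg_left (h.summable.sum_le_tsum _ fun i _ => ?_) hC
    have := h.one_le_scale i
    positivity
  have hγA : ∀ n, ‖γ n • A n‖ ≤ K * c ^ 2 := fun n => by
    rw [norm_smul, Real.norm_of_nonneg (h.weight_nonneg n)]
    calc γ n * ‖A n‖ ≤ γ n * (K * G n) := mul_le_mul_of_nonneg_left (hA n) (h.weight_nonneg n)
      _ = K * (a n / decay a (n + 1) * G n) := by simp only [hγ]; ring
      _ ≤ K * c ^ 2 := mul_le_mul_of_nonneg_left (h.weight_mul_growth_le_const n) hK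
  have e : ∑ i ∈ Finset.range n, γ i • (A i - A' i) =
      (γ 0 • A 0 - γ n • A n + ∑ i ∈ Finset.range n, (γ (i + 1) - γ i) • A (i + 1)) +
        ∑ i ∈ Finset.range n, γ i • (A (i + 1) - A' i) := by
    rw [← sum_smul_sub_succ, ← Finset.sum_add_distrib]
    refine Finset.sum_congr rfl fun i _ => ?_
    module
  rw [e]
  refine (norm_add_le _ _).trans (add_le_add ((norm_add_le _ _).trans (add_le_add
    ((norm_sub_le _ _).trans (add_le_add (hγA 0) (hγA n))) ?_)) ?_)
  · refine (norm_sum_le _ _).trans (le_trans (Finset.sum_le_sum fun i _ => ?_)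
      (hpart _ (by positivity)))
    rw [norm_smul, Real.norm_eq_abs]
    calc |γ (i + 1) - γ i| * ‖A (i + 1)‖ ≤ |γ (i + 1) - γ i| * (K * G (i + 1)) :=
          mul_le_mul_of_nonneg_left (hA _) (abs_nonneg _)
      _ = K * (|γ (i + 1) - γ i| * G (i + 1)) := by ring
      _ ≤ K * (2 * (c ^ 2 + c ^ 3) * (1 / s i ^ 6)) :=
          mul_le_mul_of_nonneg_left (h.weight_variation_le i) hK
      _ = _ := by ring
  · refine (norm_sum_le _ _).trans (le_trans (Finset.sum_le_sum fun i _ => ?_)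
      (hpart _ (mul_nonneg hK (pow_nonneg hc 3))))
    rw [norm_smul, Real.norm_of_nonneg (h.weight_nonneg i)]
    calc γ i * ‖A (i + 1) - A' i‖ ≤ γ i * (K * (a i * G i)) :=
          mul_le_mul_of_nonneg_left (hA' i) (h.weight_nonneg i)
      _ = K * (a i / decay a (i + 1) * (a i * G i)) := by simp only [hγ]; ring
      _ ≤ K * (c ^ 3 * (1 / s i ^ 6)) := mul_le_mul_of_nonneg_left (h.weight_mul_step_le i) hK
      _ = _ := by ring

end IsTameStep

end Deterministic

/-! ### Asymptotics of the learning rates -/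

section LearningRate

variable {Cα ν : ℝ}

theorem one_le_log_natCast_add_three (t : ℕ) : 1 ≤ Real.log ((t : ℝ) + 3) := by
  rw [Real.le_log_iff_exp_le (by positivity)]
  have h0 : (0 : ℝ) ≤ t := Nat.cast_nonneg t
  linarith [Real.exp_one_lt_d9]

theorem log_add_one_le_log_add_inv {x : ℝ} (hx : 0 < x) :
    Real.log (x + 1) ≤ Real.log x + 1 / x := by
  have e : x + 1 = x * (1 + 1 / x) := by field_simp
  rw [e, Real.log_mul hx.ne' (by positivity)]
  have := Real.log_le_sub_one_of_pos (show 0 < 1 + 1 / x by positivity)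
  linarith

theorem learningRate_pos (hC : 0 < Cα) (t : ℕ) : 0 < learningRate Cα ν t := by
  have := one_le_log_natCast_add_three t
  rw [learningRate]
  positivity

theorem learningRate_le_div (hC : 0 < Cα) (hν0 : 0 < ν) (t : ℕ) :
    learningRate Cα ν t ≤ Cα / ((t : ℝ) + 1) := by
  have h := Real.one_le_rpow (one_le_log_natCast_add_three t) hν0.le
  refine div_le_div_of_nonneg_left hC.le (by positivity) ?_
  nlinarith [Nat.cast_nonneg (α := ℝ) t]

theorem learningRate_succ_le (hC : 0 < Cα) (hν0 : 0 < ν) (t : ℕ) :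
    learningRate Cα ν (t + 1) ≤ learningRate Cα ν t := by
  have h1 := one_le_log_natCast_add_three t
  have h0 : (0 : ℝ) ≤ t := Nat.cast_nonneg t
  rw [learningRate, learningRate]
  refine div_le_div_of_nonneg_left hC.le (by positivity) ?_
  push_cast
  have h2 : Real.log ((t : ℝ) + 3) ≤ Real.log ((t : ℝ) + 1 + 3) :=
    Real.log_le_log (by positivity) (by linarith)
  exact mul_le_mul (by linarith) (Real.rpow_le_rpow (by linarith) h2 hν0.le) (by positivity)
    (by positivity)

theorem learningRate_antitone (hC : 0 < Cα) (hν0 : 0 < ν) : Antitone (learningRate Cα ν) :=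
  antitone_nat_of_succ_le (learningRate_succ_le hC hν0)

/-- For `x = t + 3` and `y = 1 / x`, `log x ≥ 1` gives `log (x + 1) ≤ (1 + y) log x`. The
denominator thus grows at most by `(1 + y) ^ 2`, and `(1 - 2 * y) * (1 + y) ^ 2 ≤ 1`. -/
theorem learningRate_sub_succ_le (hC : 0 < Cα) (hν0 : 0 < ν) (hν1 : ν < 1) (t : ℕ) :
    learningRate Cα ν t - learningRate Cα ν (t + 1) ≤ 2 * Cα / ((t : ℝ) + 1) ^ 2 := by
  have h1 := one_le_log_natCast_add_three t
  have h0 : (0 : ℝ) ≤ t := Nat.cast_nonneg t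
  set x : ℝ := (t : ℝ) + 3 with hx
  have hx0 : 0 < x := by positivity
  set y : ℝ := 1 / x with hy
  have hy0 : 0 < y := by positivity
  have hlog : Real.log (x + 1) ≤ Real.log x * (1 + y) := by
    have := log_add_one_le_log_add_inv hx0
    nlinarith
  have hlog0 : 0 ≤ Real.log (x + 1) := Real.log_nonneg (by linarith)
  have hpow : Real.log (x + 1) ^ ν ≤ Real.log x ^ ν * (1 + y) := by
    calc Real.log (x + 1) ^ ν ≤ (Real.log x * (1 + y)) ^ ν :=
          Real.rpow_le_rpow hlog0 hlog hν0.le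
      _ = Real.log x ^ ν * (1 + y) ^ ν := Real.mul_rpow (by linarith) (by positivity)
      _ ≤ Real.log x ^ ν * (1 + y) := by
          refine mul_le_mul_of_nonneg_left ?_ (by positivity)
          calc (1 + y) ^ ν ≤ (1 + y) ^ (1 : ℝ) :=
                Real.rpow_le_rpow_of_exponent_le (by linarith) hν1.le
            _ = 1 + y := Real.rpow_one _
  have hD : 0 < x * Real.log x ^ ν := by positivity
  have hlx : 0 < Real.log (x + 1) := Real.log_pos (by linarith)
  have hsucc : learningRate Cα ν (t + 1) = Cα / ((x + 1) * Real.log (x + 1) ^ ν) := by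
    rw [learningRate]; push_cast; rw [show (t : ℝ) + 1 + 3 = x + 1 by rw [hx]; ring]
  have hden : (x + 1) * Real.log (x + 1) ^ ν ≤ x * Real.log x ^ ν * (1 + y) ^ 2 := by
    calc (x + 1) * Real.log (x + 1) ^ ν ≤ (x + 1) * (Real.log x ^ ν * (1 + y)) :=
          mul_le_mul_of_nonneg_left hpow (by positivity)
      _ = x * Real.log x ^ ν * (1 + y) ^ 2 := by rw [hy]; field_simp
  have hge : learningRate Cα ν t * (1 - 2 * y) ≤ learningRate Cα ν (t + 1) := by
    rw [hsucc, le_div_iff₀ (by positivity)]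
    have hα : learningRate Cα ν t = Cα / (x * Real.log x ^ ν) := rfl
    by_cases hy2 : 0 ≤ 1 - 2 * y
    · calc learningRate Cα ν t * (1 - 2 * y) * ((x + 1) * Real.log (x + 1) ^ ν)
          ≤ learningRate Cα ν t * (1 - 2 * y) * (x * Real.log x ^ ν * (1 + y) ^ 2) :=
            mul_le_mul_of_nonneg_left hden (mul_nonneg (learningRate_pos hC t).le hy2)
        _ = Cα * ((1 - 2 * y) * (1 + y) ^ 2) := by rw [hα]; field_simp
        _ ≤ Cα * 1 := mul_le_mul_of_nonneg_left (by nlinarith [pow_pos hy0 3, sq_nonneg y]) hC.le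
        _ = Cα := mul_one _
    · have : learningRate Cα ν t * (1 - 2 * y) * ((x + 1) * Real.log (x + 1) ^ ν) ≤ 0 :=
        mul_nonpos_of_nonpos_of_nonneg
          (mul_nonpos_of_nonneg_of_nonpos (learningRate_pos hC t).le (by linarith))
          (by positivity)
      linarith
  have hyt : y ≤ 1 / ((t : ℝ) + 1) := one_div_le_one_div_of_le (by positivity) (by linarith)
  calc learningRate Cα ν t - learningRate Cα ν (t + 1) ≤ learningRate Cα ν t * (2 * y) := by
        linarith
    _ ≤ Cα / ((t : ℝ) + 1) * (2 * (1 / ((t : ℝ) + 1))) :=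
        mul_le_mul (learningRate_le_div hC hν0 t) (by linarith) (by positivity) (by positivity)
    _ = 2 * Cα / ((t : ℝ) + 1) ^ 2 := by field_simp

theorem sum_range_inv_le_log (n : ℕ) :
    ∑ j ∈ Finset.range (n + 1), 1 / ((j : ℝ) + 1) ≤ 1 + Real.log ((n : ℝ) + 1) := by
  have h := harmonic_le_one_add_log (n + 1)
  simp only [harmonic] at h
  push_cast at h
  simpa using h

theorem exists_learningRate_le_div (hC : 0 < Cα) (hν0 : 0 < ν) {ε : ℝ} (hε : 0 < ε) :
    ∃ N : ℕ, ∀ t, N ≤ t → learningRate Cα ν t ≤ ε / ((t : ℝ) + 1) := by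
  have h : Filter.Tendsto (fun t : ℕ => Real.log ((t : ℝ) + 3) ^ ν) Filter.atTop Filter.atTop :=
    (tendsto_rpow_atTop hν0).comp (Real.tendsto_log_atTop.comp
      (Filter.tendsto_atTop_add_const_right _ _ tendsto_natCast_atTop_atTop))
  obtain ⟨N, hN⟩ := Filter.eventually_atTop.1 (h.eventually_ge_atTop (Cα / ε))
  refine ⟨N, fun t ht => ?_⟩
  have h1 := hN t ht
  have h0 : (0 : ℝ) ≤ t := Nat.cast_nonneg t
  have h2 := one_le_log_natCast_add_three t
  rw [div_le_iff₀ hε] at h1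
  rw [learningRate, div_le_div_iff₀ (by positivity) (by positivity)]
  calc Cα * ((t : ℝ) + 1) ≤ Real.log ((t : ℝ) + 3) ^ ν * ε * ((t : ℝ) + 3) :=
        mul_le_mul h1 (by linarith) (by positivity) (by positivity)
    _ = ε * (((t : ℝ) + 3) * Real.log ((t : ℝ) + 3) ^ ν) := by ring

/-- This is where `ν > 0` matters: `log ^ ν` beats every constant, so `ε` is arbitrary and
exponentials of the sum are `O(n ^ ε)`. -/
theorem exists_sum_learningRate_le (hC : 0 < Cα) (hν0 : 0 < ν) {ε : ℝ} (hε : 0 < ε) :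
    ∃ c : ℝ, ∀ n : ℕ, ∑ j ∈ Finset.range (n + 1), learningRate Cα ν j ≤
      ε * Real.log ((n : ℝ) + 1) + c := by
  obtain ⟨N, hN⟩ := exists_learningRate_le_div hC hν0 hε
  refine ⟨ε + ∑ j ∈ Finset.range N, learningRate Cα ν j, fun n => ?_⟩
  have hterm : ∀ j, learningRate Cα ν j ≤
      ε * (1 / ((j : ℝ) + 1)) + if j ∈ Finset.range N then learningRate Cα ν j else 0 := fun j => by
    split_ifs with h
    · have : 0 < ε * (1 / ((j : ℝ) + 1)) := by positivity
      linarith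
    · have := hN j (by simpa using h)
      rw [add_zero, mul_one_div]
      exact this
  have hsub : ∑ j ∈ Finset.range (n + 1), (if j ∈ Finset.range N then learningRate Cα ν j else 0) ≤
      ∑ j ∈ Finset.range N, learningRate Cα ν j := by
    rw [← Finset.sum_filter]
    refine Finset.sum_le_sum_of_subset_of_nonneg (fun j hj => (Finset.mem_filter.1 hj).2)
      fun j _ _ => (learningRate_pos hC j).le
  calc ∑ j ∈ Finset.range (n + 1), learningRate Cα ν j
      ≤ ε * ∑ j ∈ Finset.range (n + 1), 1 / ((j : ℝ) + 1) +
        ∑ j ∈ Finset.range (n + 1), (if j ∈ Finset.range N then learningRate Cα ν j else 0) := by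
        rw [Finset.mul_sum, ← Finset.sum_add_distrib]
        exact Finset.sum_le_sum fun j _ => hterm j
    _ ≤ ε * (1 + Real.log ((n : ℝ) + 1)) + ∑ j ∈ Finset.range N, learningRate Cα ν j :=
        add_le_add (mul_le_mul_of_nonneg_left (sum_range_inv_le_log n) hε.le) hsub
    _ = _ := by ring

theorem timeScale_nonneg (hν1 : ν < 1) (t : ℕ) : 0 ≤ timeScale ν t :=
  div_nonneg (Real.rpow_nonneg (Real.log_nonneg
    (by have : (0 : ℝ) ≤ t := Nat.cast_nonneg t; linarith)) _) (by linarith)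

theorem timeScale_mono (hν1 : ν < 1) : Monotone (timeScale ν) := fun s t hst => by
  have hs : (0 : ℝ) ≤ s := Nat.cast_nonneg s
  have hst' : (s : ℝ) ≤ t := Nat.cast_le.2 hst
  exact div_le_div_of_nonneg_right (Real.rpow_le_rpow (Real.log_nonneg (by linarith))
    (Real.log_le_log (by linarith) (by linarith)) (by linarith)) (by linarith)

/-- `1 / (x log ^ ν x)` is the derivative of `log ^ (1 - ν) x / (1 - ν)`; the discrete version is
Bernoulli's inequality with exponent `1 - ν`. The shift by two matches `log (t + 1)` in `timeScale`
with `log (t + 3)` in `learningRate`. -/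
theorem timeScale_sub_le (hC : 0 < Cα) (hν0 : 0 < ν) (hν1 : ν < 1) (t : ℕ) :
    Cα * (timeScale ν (t + 3) - timeScale ν (t + 2)) ≤ learningRate Cα ν t := by
  have h1 := one_le_log_natCast_add_three t
  set x : ℝ := (t : ℝ) + 3 with hx
  have hx0 : 0 < x := by positivity
  have hl0 : 0 < Real.log x := by linarith
  have hθ : 0 < 1 - ν := by linarith
  have e1 : timeScale ν (t + 3) = Real.log (x + 1) ^ (1 - ν) / (1 - ν) := by
    rw [timeScale]; push_cast; rfl
  have e2 : timeScale ν (t + 2) = Real.log x ^ (1 - ν) / (1 - ν) := by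
    rw [timeScale]; push_cast; rw [show (t : ℝ) + 2 + 1 = x by rw [hx]; ring]
  have hy : 0 < 1 / x / Real.log x := by positivity
  have key : Real.log (x + 1) ^ (1 - ν) ≤
      Real.log x ^ (1 - ν) + (1 - ν) * (1 / (x * Real.log x ^ ν)) := by
    calc Real.log (x + 1) ^ (1 - ν) ≤ (Real.log x * (1 + 1 / x / Real.log x)) ^ (1 - ν) := by
          refine Real.rpow_le_rpow (Real.log_nonneg (by linarith)) ?_ hθ.le
          have := log_add_one_le_log_add_inv hx0
          rw [mul_add, mul_one, mul_div_cancel₀ _ hl0.ne']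
          exact this
      _ = Real.log x ^ (1 - ν) * (1 + 1 / x / Real.log x) ^ (1 - ν) :=
          Real.mul_rpow hl0.le (by positivity)
      _ ≤ Real.log x ^ (1 - ν) * (1 + (1 - ν) * (1 / x / Real.log x)) :=
          mul_le_mul_of_nonneg_left
            (rpow_one_add_le_one_add_mul_self (by linarith) hθ.le (by linarith)) (by positivity)
      _ = _ := by
          rw [Real.rpow_sub hl0, Real.rpow_one]
          field_simp
  rw [e1, e2, learningRate, ← sub_div, ← mul_one_div Cα (_ * _)]
  refine mul_le_mul_of_nonneg_left ?_ hC.le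
  rw [div_le_iff₀ hθ]
  linarith

theorem mul_timeScale_sub_le_sum (hC : 0 < Cα) (hν0 : 0 < ν) (hν1 : ν < 1) (t n : ℕ) :
    Cα * (timeScale ν (t + n) - timeScale ν (t + 2)) ≤
      ∑ j ∈ Finset.range n, learningRate Cα ν (t + j) := by
  have h : Cα * (timeScale ν (t + n + 2) - timeScale ν (t + 2)) ≤
      ∑ j ∈ Finset.range n, learningRate Cα ν (t + j) := by
    induction n with
    | zero => simp
    | succ n ih =>
      rw [Finset.sum_range_succ]
      have := timeScale_sub_le hC hν0 hν1 (t + n)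
      rw [show t + (n + 1) + 2 = t + n + 3 by ring]
      linarith
  exact le_trans (mul_le_mul_of_nonneg_left
    (sub_le_sub_right (timeScale_mono hν1 (by omega)) _) hC.le) h

theorem rpow_quarter_pow_four (n : ℕ) : (((n : ℝ) + 1) ^ (1 / 4 : ℝ)) ^ 4 = (n : ℝ) + 1 := by
  rw [← Real.rpow_natCast, ← Real.rpow_mul (by positivity)]
  norm_num

theorem exists_isTameStep_learningRate (hC : 0 < Cα) (hν0 : 0 < ν) (hν1 : ν < 1) {K R : ℝ}
    (hK : 0 ≤ K) (hR : 0 ≤ R) : ∃ (t₀ : ℕ) (c : ℝ), 1 ≤ t₀ ∧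
      IsTameStep (fun n => learningRate Cα ν (t₀ + n))
        (fun n => R * Real.exp (K * ∑ i ∈ Finset.range (t₀ + n), learningRate Cα ν i))
        (fun n => ((n : ℝ) + 1) ^ (1 / 4 : ℝ)) c := by
  obtain ⟨N, hN⟩ := exists_learningRate_le_div hC hν0 (show (0 : ℝ) < 1 / 2 by norm_num)
  -- The growth contributes `K` and the inverse decay `2` to the exponent, so this `ε` makes their
  -- product `O(n ^ (1/4))`.
  obtain ⟨c₁, hc₁⟩ := exists_sum_learningRate_le hC hν0 (show 0 < 1 / (4 * (K + 2)) by positivity)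
  set α := learningRate Cα ν with hα
  have hα0 : ∀ t, 0 < α t := learningRate_pos hC
  set t₀ := N + 1
  set c₂ := R * Real.exp (K * ∑ i ∈ Finset.range t₀, α i) * Real.exp ((K + 2) * c₁)
  have hc₂ : 0 ≤ c₂ := by positivity
  have hhalf : ∀ n, α (t₀ + n) ≤ 1 / 2 := fun n => by
    refine (hN (t₀ + n) (by omega)).trans (div_le_self (by norm_num) ?_)
    have : (0 : ℝ) ≤ ((t₀ + n : ℕ) : ℝ) := Nat.cast_nonneg _
    linarith
  have hcast : ∀ n : ℕ, (n : ℝ) + 1 ≤ ((t₀ + n : ℕ) : ℝ) + 1 := fun n => by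
    push_cast
    linarith [Nat.cast_nonneg (α := ℝ) t₀]
  refine ⟨t₀, 2 * Cα + c₂, by omega, by positivity, fun n => hα0 _, hhalf,
    fun n => learningRate_antitone hC hν0 (by omega), fun n => ?_, fun n => ?_,
    fun n => by positivity, fun n => ?_, fun n => ?_, fun n => ?_, ?_⟩
  · rw [rpow_quarter_pow_four]
    refine (learningRate_le_div hC hν0 _).trans (div_le_div₀ (by positivity) (by linarith)
      (by positivity) (hcast n))
  · rw [show (8 : ℕ) = 4 * 2 from rfl, pow_mul, rpow_quarter_pow_four]
    refine (learningRate_sub_succ_le hC hν0 hν1 _).trans (div_le_div₀ (by positivity)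
      (by linarith) (by positivity) (pow_le_pow_left₀ (by positivity) (hcast n) 2))
  · have hsum : ∑ j ∈ Finset.range (n + 1), α (t₀ + j) ≤ ∑ j ∈ Finset.range (n + 1), α j :=
      Finset.sum_le_sum fun j _ => learningRate_antitone hC hν0 (by omega)
    have hsum' : ∑ i ∈ Finset.range (t₀ + n), α i ≤
        ∑ i ∈ Finset.range t₀, α i + ∑ j ∈ Finset.range (n + 1), α j := by
      rw [Finset.sum_range_add]
      have : ∑ j ∈ Finset.range n, α (t₀ + j) ≤ ∑ j ∈ Finset.range (n + 1), α (t₀ + j) := by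
        rw [Finset.sum_range_succ]
        linarith [hα0 (t₀ + n)]
      linarith
    have hinv := inv_decay_le_exp (a := fun n => α (t₀ + n)) (fun n => (hα0 _).le) hhalf (n + 1)
    have hn1 : (0 : ℝ) < (n : ℝ) + 1 := by positivity
    rw [div_eq_mul_inv]
    calc R * Real.exp (K * ∑ i ∈ Finset.range (t₀ + n), α i) *
          (decay (fun n => α (t₀ + n)) (n + 1))⁻¹
        ≤ R * Real.exp (K * (∑ i ∈ Finset.range t₀, α i + ∑ j ∈ Finset.range (n + 1), α j)) *
          Real.exp (2 * ∑ j ∈ Finset.range (n + 1), α j) := by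
          refine mul_le_mul ?_ (hinv.trans (Real.exp_le_exp.2 (by linarith)))
            (inv_nonneg.2 (decay_pos (fun n => by linarith [hhalf n]) _).le) (by positivity)
          exact mul_le_mul_of_nonneg_left
            (Real.exp_le_exp.2 (mul_le_mul_of_nonneg_left hsum' hK)) hR
      _ = R * Real.exp (K * ∑ i ∈ Finset.range t₀, α i) *
          Real.exp ((K + 2) * ∑ j ∈ Finset.range (n + 1), α j) := by
          rw [mul_assoc, mul_assoc, ← Real.exp_add, ← Real.exp_add]
          ring_nf
      _ ≤ R * Real.exp (K * ∑ i ∈ Finset.range t₀, α i) *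
          Real.exp ((K + 2) * (1 / (4 * (K + 2)) * Real.log ((n : ℝ) + 1) + c₁)) := by
          refine mul_le_mul_of_nonneg_left (Real.exp_le_exp.2 ?_) (by positivity)
          exact mul_le_mul_of_nonneg_left (hc₁ n) (by positivity)
      _ = c₂ * ((n : ℝ) + 1) ^ (1 / 4 : ℝ) := by
          rw [Real.rpow_def_of_pos hn1, mul_assoc _ (Real.exp ((K + 2) * c₁)), ← Real.exp_add]
          congr 2
          field_simp
          ring
      _ ≤ (2 * Cα + c₂) * ((n : ℝ) + 1) ^ (1 / 4 : ℝ) :=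
          mul_le_mul_of_nonneg_right (by linarith) (by positivity)
  · exact Real.one_le_rpow (by linarith [Nat.cast_nonneg (α := ℝ) n]) (by norm_num)
  · refine le_of_pow_le_pow_left₀ (n := 4) (by norm_num) (by positivity) ?_
    rw [mul_pow, rpow_quarter_pow_four, rpow_quarter_pow_four]
    push_cast
    linarith [Nat.cast_nonneg (α := ℝ) n]
  · have h := (summable_nat_add_iff (f := fun n : ℕ => 1 / (n : ℝ) ^ (3 / 2 : ℝ)) 1).2
      (Real.summable_one_div_nat_rpow.2 (by norm_num))
    refine h.congr fun n => ?_
    rw [← Real.rpow_natCast, ← Real.rpow_mul (by positivity)]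
    push_cast
    norm_num

end LearningRate

/-! ### Pathwise bounds on the iterates -/

section Iterates

variable {E 𝒴 Ω : Type*} [NormedAddCommGroup E] [NormedSpace ℝ E]

/-- A discrete Gronwall inequality using only the linear growth of `H`; it holds on every path. -/
theorem one_add_norm_iterates_le {H : E → 𝒴 → E} {L : ℝ} (hL : 0 ≤ L)
    (hH : ∀ w y, ‖H w y‖ ≤ L * (1 + ‖w‖)) {α : ℕ → ℝ} (hα : ∀ t, 0 ≤ α t) (Y : ℕ → Ω → 𝒴)
    (w0 : Ω → E) (ω : Ω) (t : ℕ) : 1 + ‖iterates H α Y w0 t ω‖ ≤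
      (1 + ‖w0 ω‖) * Real.exp ((L + 1) * ∑ i ∈ Finset.range t, α i) := by
  induction t with
  | zero => simp [iterates]
  | succ t ih =>
    set w := iterates H α Y w0 t ω
    have h1 : ‖iterates H α Y w0 (t + 1) ω‖ ≤ ‖w‖ + α t * (L * (1 + ‖w‖) + ‖w‖) := by
      refine (norm_add_le _ _).trans (add_le_add_right ?_ _)
      rw [norm_smul, Real.norm_of_nonneg (hα t)]
      exact mul_le_mul_of_nonneg_left
        ((norm_sub_le _ _).trans (add_le_add_left (hH _ _) _)) (hα t)
    calc 1 + ‖iterates H α Y w0 (t + 1) ω‖ ≤ (1 + ‖w‖) * ((L + 1) * α t + 1) := by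
          linarith [hα t]
      _ ≤ (1 + ‖w‖) * Real.exp ((L + 1) * α t) :=
          mul_le_mul_of_nonneg_left (Real.add_one_le_exp _) (by positivity)
      _ ≤ (1 + ‖w0 ω‖) * Real.exp ((L + 1) * ∑ i ∈ Finset.range t, α i) *
          Real.exp ((L + 1) * α t) := mul_le_mul_of_nonneg_right ih (Real.exp_pos _).le
      _ = _ := by rw [mul_assoc, ← Real.exp_add, Finset.sum_range_succ, mul_add]

theorem norm_iterates_succ_sub_le {H : E → 𝒴 → E} {L : ℝ}
    (hH : ∀ w y, ‖H w y‖ ≤ L * (1 + ‖w‖)) {α : ℕ → ℝ} (hα : ∀ t, 0 ≤ α t) (Y : ℕ → Ω → 𝒴)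
    (w0 : Ω → E) (ω : Ω) (t : ℕ) : ‖iterates H α Y w0 (t + 1) ω - iterates H α Y w0 t ω‖ ≤
      (L + 1) * (α t * (1 + ‖iterates H α Y w0 t ω‖)) := by
  rw [iterates, add_sub_cancel_left, norm_smul, Real.norm_of_nonneg (hα t)]
  have := (norm_sub_le (H (iterates H α Y w0 t ω) (Y (t + 1) ω)) (iterates H α Y w0 t ω)).trans
    (add_le_add_left (hH _ _) _)
  calc _ ≤ α t * (L * (1 + ‖iterates H α Y w0 t ω‖) + ‖iterates H α Y w0 t ω‖) :=
        mul_le_mul_of_nonneg_left this (hα t)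
    _ ≤ α t * ((L + 1) * (1 + ‖iterates H α Y w0 t ω‖)) :=
        mul_le_mul_of_nonneg_left (by linarith) (hα t)
    _ = _ := by ring

theorem measurable_iterates [FiniteDimensional ℝ E] [MeasurableSpace E] [BorelSpace E]
    [MeasurableSpace 𝒴] {mΩ : MeasurableSpace Ω} {μ : Measure Ω} {ℱ : Filtration ℕ mΩ}
    {P : Kernel 𝒴 𝒴} {Y : ℕ → Ω → 𝒴} (hY : IsMarkovChain μ ℱ P Y) {H : E → 𝒴 → E}
    (hH : IsRegularUpdate H) (α : ℕ → ℝ) {w0 : Ω → E} (hw0 : Measurable[ℱ 0] w0) (t : ℕ) :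
    Measurable[ℱ t] (iterates H α Y w0 t) := by
  induction t with
  | zero => exact hw0
  | succ t ih =>
    obtain ⟨L, hL⟩ := hH.lipschitz
    have hHm := measurable_uncurry_of_lipschitz hH.measurable hL
    have hwt : Measurable[ℱ (t + 1)] (iterates H α Y w0 t) := ih.mono (ℱ.mono t.le_succ) le_rfl
    exact hwt.add (((hHm.comp (hwt.prodMk (hY.adapted (t + 1) (by omega)))).sub hwt).const_smul _)

end Iterates

/-! ### From tails to moments -/

section Moments

variable {Ω : Type*} {mΩ : MeasurableSpace Ω} {μ : Measure Ω} [IsProbabilityMeasure μ]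

/-- Layer cake, split at `b`: below `b` the probability is at most `1`, above it the integrand is
dominated by that of the Gamma integral. -/
theorem lintegral_rpow_le_of_exp_tail {Q : Ω → ℝ} (hQ0 : ∀ ω, 0 ≤ Q ω) (hQ : Measurable Q)
    {b q : ℝ} (hb : 0 ≤ b) (hq : 0 < q)
    (htail : ∀ s, b < s → μ {ω | s < Q ω} ≤ ENNReal.ofReal (Real.exp (b - s))) :
    ∫⁻ ω, ENNReal.ofReal (Q ω ^ q) ∂μ ≤
      ENNReal.ofReal (b ^ q + q * (Real.exp b * Real.Gamma q)) := by
  have hΓ : 0 < Real.Gamma q := Real.Gamma_pos_of_pos hq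
  rw [lintegral_rpow_eq_lintegral_meas_lt_mul μ (Filter.Eventually.of_forall hQ0) hQ.aemeasurable
    hq]
  have h1 : ∫⁻ s in Set.Ioc 0 b, μ {ω | s < Q ω} * ENNReal.ofReal (s ^ (q - 1)) ≤
      ENNReal.ofReal (b ^ q / q) := by
    have hint : IntegrableOn (fun s : ℝ => s ^ (q - 1)) (Set.Ioc 0 b) :=
      (intervalIntegrable_iff_integrableOn_Ioc_of_le hb).1
        (intervalIntegral.intervalIntegrable_rpow' (by linarith))
    have hval : ∫ s in Set.Ioc 0 b, s ^ (q - 1) = b ^ q / q := by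
      rw [← intervalIntegral.integral_of_le hb, integral_rpow (Or.inl (by linarith))]
      simp [Real.zero_rpow hq.ne']
    rw [← hval, ofReal_integral_eq_lintegral_ofReal hint
      ((ae_restrict_mem measurableSet_Ioc).mono fun s hs => Real.rpow_nonneg hs.1.le _)]
    refine lintegral_mono fun s => ?_
    calc μ {ω | s < Q ω} * ENNReal.ofReal (s ^ (q - 1)) ≤ 1 * ENNReal.ofReal (s ^ (q - 1)) :=
          mul_le_mul_left prob_le_one _
      _ = _ := one_mul _
  have h2 : ∫⁻ s in Set.Ioi b, μ {ω | s < Q ω} * ENNReal.ofReal (s ^ (q - 1)) ≤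
      ENNReal.ofReal (Real.exp b * Real.Gamma q) := by
    have hint := (Real.GammaIntegral_convergent hq).const_mul (Real.exp b)
    rw [Real.Gamma_eq_integral hq, ← integral_const_mul, ofReal_integral_eq_lintegral_ofReal hint
      ((ae_restrict_mem measurableSet_Ioi).mono fun s hs => mul_nonneg (Real.exp_pos _).le
        (mul_nonneg (Real.exp_pos _).le (Real.rpow_nonneg (le_of_lt hs) _)))]
    refine (setLIntegral_mono' measurableSet_Ioi fun s hs => ?_).trans
      (lintegral_mono_set (Set.Ioi_subset_Ioi hb))
    calc μ {ω | s < Q ω} * ENNReal.ofReal (s ^ (q - 1))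
        ≤ ENNReal.ofReal (Real.exp (b - s)) * ENNReal.ofReal (s ^ (q - 1)) :=
          mul_le_mul_left (htail s hs) _
      _ = ENNReal.ofReal (Real.exp b * (Real.exp (-s) * s ^ (q - 1))) := by
          rw [← ENNReal.ofReal_mul (Real.exp_pos _).le, sub_eq_add_neg, Real.exp_add, mul_assoc]
  calc _ ≤ ENNReal.ofReal q * (ENNReal.ofReal (b ^ q / q) +
        ENNReal.ofReal (Real.exp b * Real.Gamma q)) := by
        refine mul_le_mul_right ?_ _
        rw [← Set.Ioc_union_Ioi_eq_Ioi hb, lintegral_union measurableSet_Ioi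
          (Set.Ioc_disjoint_Ioi le_rfl)]
        exact add_le_add h1 h2
    _ = _ := by
        rw [← ENNReal.ofReal_add (by positivity) (by positivity), ← ENNReal.ofReal_mul hq.le]
        congr 1
        field_simp

/-- A tail bound that is polynomial in `log (1 / δ)` implies factorial growth of the moments. -/
theorem integral_rpow_le_of_tail {X : Ω → ℝ} (hX0 : ∀ ω, 0 ≤ X ω) (hX : Measurable X) {a b : ℝ}
    (ha : 0 < a) (hb : 0 < b) {C : ℕ} (hC : 1 ≤ C)
    (htail : ∀ δ : ℝ, 0 < δ → δ < 1 →
      ENNReal.ofReal (1 - δ) ≤ μ {ω | X ω ≤ a * (Real.log (1 / δ) + b) ^ C})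
    {p : ℝ} (hp : 1 ≤ p) :
    Integrable (fun ω => X ω ^ p) μ ∧ ∫ ω, X ω ^ p ∂μ ≤
      (a * b ^ C) ^ p + C * p * a ^ p * Real.exp b * realFactorial (C * p) := by
  have hC1 : (1 : ℝ) ≤ C := by exact_mod_cast hC
  have hC0 : (C : ℝ) ≠ 0 := by positivity
  have hp0 : 0 < p := by linarith
  set q : ℝ := C * p with hq
  have hq1 : 1 ≤ q := one_le_mul_of_one_le_of_one_le hC1 hp
  -- The `C`-th root makes the tail exponential: `δ = exp (b - s)` turns `log (1 / δ) + b` into `s`.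
  set Q : Ω → ℝ := fun ω => (X ω / a) ^ (C : ℝ)⁻¹ with hQ
  have hXa : ∀ ω, 0 ≤ X ω / a := fun ω => div_nonneg (hX0 ω) ha.le
  have hQ0 : ∀ ω, 0 ≤ Q ω := fun ω => Real.rpow_nonneg (hXa ω) _
  have hQm : Measurable Q := (hX.div_const a).pow_const _
  have hXQ : ∀ ω, X ω ^ p = a ^ p * Q ω ^ q := fun ω => by
    rw [hQ, ← Real.rpow_mul (hXa ω), hq, inv_mul_cancel_left₀ hC0,
      ← Real.mul_rpow ha.le (hXa ω), mul_div_cancel₀ _ ha.ne']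
  have hQt : ∀ s, b < s → μ {ω | s < Q ω} ≤ ENNReal.ofReal (Real.exp (b - s)) := fun s hs => by
    have hs0 : 0 < s := hb.trans hs
    have h := htail (Real.exp (b - s)) (Real.exp_pos _) (by rw [Real.exp_lt_one_iff]; linarith)
    rw [one_div, Real.log_inv, Real.log_exp, neg_sub, sub_add_cancel] at h
    have hsub : {ω | X ω ≤ a * s ^ C} ⊆ {ω | s < Q ω}ᶜ := fun ω hω => by
      simp only [Set.mem_ofPred_eq, Set.mem_compl_iff, not_lt] at hω ⊢
      rw [hQ, Real.rpow_inv_le_iff_of_pos (hXa ω) hs0.le (by linarith), Real.rpow_natCast,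
        div_le_iff₀ ha, mul_comm]
      exact hω
    have hms : MeasurableSet {ω | s < Q ω} := measurableSet_lt measurable_const hQm
    have h2 := h.trans (measure_mono hsub)
    rw [prob_compl_eq_one_sub hms, ENNReal.ofReal_sub _ (Real.exp_pos _).le,
      ENNReal.ofReal_one] at h2
    exact (ENNReal.sub_le_sub_iff_left prob_le_one ENNReal.one_ne_top).1 h2
  have hl := lintegral_rpow_le_of_exp_tail (q := q) hQ0 hQm hb.le (by linarith) hQt
  have hΓ : 0 < Real.Gamma q := Real.Gamma_pos_of_pos (by linarith)
  have hbd : 0 ≤ b ^ q + q * (Real.exp b * Real.Gamma q) := by positivity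
  have hQi : Integrable (fun ω => Q ω ^ q) μ := by
    refine ⟨(hQm.pow_const q).aestronglyMeasurable, ?_⟩
    rw [hasFiniteIntegral_iff_ofReal
      (Filter.Eventually.of_forall fun ω => Real.rpow_nonneg (hQ0 ω) _)]
    exact hl.trans_lt ENNReal.ofReal_lt_top
  have hQb : ∫ ω, Q ω ^ q ∂μ ≤ b ^ q + q * (Real.exp b * Real.Gamma q) := by
    rw [integral_eq_lintegral_of_nonneg_ae
      (Filter.Eventually.of_forall fun ω => Real.rpow_nonneg (hQ0 ω) _) hQi.aestronglyMeasurable]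
    exact ENNReal.toReal_le_of_le_ofReal hbd hl
  simp only [hXQ]
  refine ⟨hQi.const_mul _, ?_⟩
  rw [integral_const_mul]
  have hfac : Real.Gamma q ≤ realFactorial q := by
    rw [realFactorial, Real.Gamma_add_one (by linarith)]
    nlinarith
  have hbq : (a * b ^ C) ^ p = a ^ p * b ^ q := by
    rw [Real.mul_rpow ha.le (by positivity), ← Real.rpow_natCast, ← Real.rpow_mul hb.le]
  calc a ^ p * ∫ ω, Q ω ^ q ∂μ ≤ a ^ p * (b ^ q + q * (Real.exp b * Real.Gamma q)) :=
        mul_le_mul_of_nonneg_left hQb (by positivity)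
    _ ≤ a ^ p * (b ^ q + q * (Real.exp b * realFactorial q)) := by gcongr
    _ = _ := by rw [hbq]; ring

end Moments

/-! ### The error along a path, with high probability -/

section Path

variable {E 𝒴 Ω : Type*} [NormedAddCommGroup E] [NormedSpace ℝ E] [FiniteDimensional ℝ E]
  [MeasurableSpace E] [BorelSpace E] [MeasurableSpace 𝒴] {mΩ : MeasurableSpace Ω} {μ : Measure Ω}
  [IsProbabilityMeasure μ] {ℱ : Filtration ℕ mΩ} {P : Kernel 𝒴 𝒴} [IsMarkovKernel P]
  {Y : ℕ → Ω → 𝒴} {d : Measure 𝒴} [IsProbabilityMeasure d] {H : E → 𝒴 → E} {w0 : Ω → E}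

theorem exists_norm_sub_le_decay (hmix : GeometricallyMixing P d) (hY : IsMarkovChain μ ℱ P Y)
    (hH : IsRegularUpdate H) (hw0 : Measurable[ℱ 0] w0) {R : ℝ} (hR : ∀ᵐ ω ∂μ, ‖w0 ω‖ ≤ R)
    {κ : ℝ} (hκ0 : 0 ≤ κ) (hκ1 : κ < 1)
    (hκ : ∀ w w' : E, ‖meanOp d H w - meanOp d H w'‖ ≤ κ * ‖w - w'‖)
    {wstar : E} (hfix : meanOp d H wstar = wstar) {ν Cα : ℝ} (hν0 : 0 < ν) (hν1 : ν < 1)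
    (hC : 0 < Cα) :
    ∃ (t₀ : ℕ) (B c : ℝ), 0 ≤ B ∧ 1 ≤ c ∧ (∀ n, learningRate Cα ν (t₀ + n) ≤ 1 / 2) ∧
      (∀ᵐ ω ∂μ, ∀ t ≤ t₀, ‖iterates H (learningRate Cα ν) Y w0 t ω - wstar‖ ≤ B) ∧
      ∀ δ : ℝ, 0 < δ → δ < 1 → ENNReal.ofReal (1 - δ) ≤ μ {ω | ∀ n : ℕ,
        ‖iterates H (learningRate Cα ν) Y w0 (t₀ + n) ω - wstar‖ ≤
          decay (fun j => (1 - κ) * learningRate Cα ν (t₀ + j)) n *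
            (B + (1 + 2 * ∑ j ∈ Finset.range n, learningRate Cα ν (t₀ + j)) *
              (B + c * (Real.log (1 / δ) + c + 2 * Real.log ((n : ℝ) + 1))))} := by
  obtain ⟨V, W, K, hVW⟩ := exists_isPoissonPair hmix hH
  obtain ⟨L, hL, -, hbd⟩ := hH.exists_bound
  have hK := hVW.nonneg
  obtain ⟨t₀, s, ht₀, htame⟩ := exists_isTameStep_learningRate (ν := ν) hC hν0 hν1
    (show 0 ≤ L + 1 by linarith) (show 0 ≤ 1 + |R| by positivity)
  set α := learningRate Cα ν
  have hα : ∀ t, 0 ≤ α t := fun t => (learningRate_pos hC t).le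
  set w := iterates H α Y w0
  set g : ℕ → ℝ := fun t => (1 + |R|) * Real.exp ((L + 1) * ∑ i ∈ Finset.range t, α i)
  set a : ℕ → ℝ := fun n => α (t₀ + n)
  set γ : ℕ → ℝ := fun n => a n / decay a (n + 1)
  have hgood : ∀ᵐ ω ∂μ, ∀ t, 1 + ‖w t ω‖ ≤ g t := by
    filter_upwards [hR] with ω hω t
    refine (one_add_norm_iterates_le hL hbd hα Y w0 ω t).trans
      (mul_le_mul_of_nonneg_right ?_ (Real.exp_pos _).le)
    linarith [le_abs_self R]
  have hγ0 : ∀ n, 0 ≤ γ n := htame.weight_nonneg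
  have hinc : ∀ᵐ ω ∂μ, ∀ i, ‖γ i • increment V W Y w (t₀ + i) ω‖ ≤
      2 * K * (γ i * g (t₀ + i)) := by
    filter_upwards [hgood] with ω hω i
    rw [norm_smul, Real.norm_of_nonneg (hγ0 i)]
    have h1 := mul_le_mul_of_nonneg_left (hω (t₀ + i)) hK
    have h2 : ‖increment V W Y w (t₀ + i) ω‖ ≤ 2 * K * g (t₀ + i) := by
      refine (norm_sub_le _ _).trans ?_
      linarith [hVW.bound_left (w (t₀ + i) ω) (Y (t₀ + i + 1) ω),
        hVW.bound_right (w (t₀ + i) ω) (Y (t₀ + i) ω)]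
    calc γ i * ‖increment V W Y w (t₀ + i) ω‖ ≤ γ i * (2 * K * g (t₀ + i)) :=
          mul_le_mul_of_nonneg_left h2 (hγ0 i)
      _ = _ := by ring
  obtain ⟨c, hc1, hc⟩ := exists_weightedSum_tail hY hVW
    (fun n => measurable_iterates hY hH α hw0 n) ht₀ hinc
    (fun i => mul_nonneg (by positivity) (mul_nonneg (hγ0 i) (htame.growth_nonneg i)))
    (htame.summable_weight_sq (2 * K))
  -- The constant `K * (L + 2)` serves both the size of `W` (`K`) and its drift along one step (`K *
  -- (L + 1)`).
  obtain ⟨B, hB0, hB⟩ := htame.exists_norm_sum_le (E := E)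
    (show 0 ≤ K * (L + 2) by positivity)
  have hstart : ∀ᵐ ω ∂μ, ∀ t ≤ t₀, ‖w t ω - wstar‖ ≤ g t₀ + ‖wstar‖ := by
    filter_upwards [hgood] with ω hω t ht
    have hg : g t ≤ g t₀ := by
      refine mul_le_mul_of_nonneg_left (Real.exp_le_exp.2 ?_) (by positivity)
      exact mul_le_mul_of_nonneg_left (Finset.sum_le_sum_of_subset_of_nonneg
        (Finset.range_subset_range.2 ht) fun i _ _ => hα i) (by positivity)
    linarith [norm_sub_le (w t ω) wstar, hω t]
  have hg0 : 0 ≤ g t₀ + ‖wstar‖ := add_nonneg (htame.growth_nonneg 0) (norm_nonneg _)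
  refine ⟨t₀, (g t₀ + ‖wstar‖) + B, c, by linarith, hc1, htame.le_half,
    hstart.mono fun ω hω t ht => (hω t ht).trans (by linarith), fun δ hδ hδ1 => ?_⟩
  refine (hc δ hδ hδ1).trans (measure_mono_ae ?_)
  filter_upwards [hgood, hstart] with ω hω hω0 hM n
  have hM' : ∀ n : ℕ, ‖weightedSum V W Y w γ t₀ n ω‖ ≤
    c * (Real.log (1 / δ) + c + 2 * Real.log ((n : ℝ) + 1)) := hM
  have hlδ : 0 ≤ Real.log (1 / δ) := Real.log_nonneg (by rw [le_div_iff₀ hδ]; linarith)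
  have hξ : ∀ n, ‖∑ i ∈ Finset.range n, (a i / decay a (i + 1)) •
      (H (w (t₀ + i) ω) (Y (t₀ + i + 1) ω) - meanOp d H (w (t₀ + i) ω))‖ ≤
      (g t₀ + ‖wstar‖) + B + c * (Real.log (1 / δ) + c + 2 * Real.log ((n : ℝ) + 1)) := fun n => by
    -- The Poisson decomposition of the noise: telescoping part plus martingale.
    have e : ∑ i ∈ Finset.range n, (a i / decay a (i + 1)) •
        (H (w (t₀ + i) ω) (Y (t₀ + i + 1) ω) - meanOp d H (w (t₀ + i) ω)) =
        (∑ i ∈ Finset.range n, (a i / decay a (i + 1)) •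
          (W (w (t₀ + i) ω) (Y (t₀ + i) ω) - W (w (t₀ + i) ω) (Y (t₀ + i + 1) ω))) +
        weightedSum V W Y w γ t₀ n ω := by
      rw [weightedSum, ← Finset.sum_add_distrib]
      refine Finset.sum_congr rfl fun i _ => ?_
      rw [← smul_add, ← hVW.sub_eq, increment]
      congr 1
      abel
    rw [e]
    refine (norm_add_le _ _).trans (add_le_add (le_trans (hB
      (fun i => W (w (t₀ + i) ω) (Y (t₀ + i) ω))
      (fun i => W (w (t₀ + i) ω) (Y (t₀ + i + 1) ω)) (fun i => ?_) (fun i => ?_) n)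
      (by linarith)) (hM' n))
    · refine (hVW.bound_right _ _).trans ?_
      calc K * (1 + ‖w (t₀ + i) ω‖) ≤ K * (L + 2) * (1 + ‖w (t₀ + i) ω‖) :=
            mul_le_mul_of_nonneg_right (by nlinarith) (by positivity)
        _ ≤ _ := mul_le_mul_of_nonneg_left (hω _) (by positivity)
    · refine (hVW.lipschitz_right _ _ _).trans ?_
      have h1 := norm_iterates_succ_sub_le hbd hα Y w0 ω (t₀ + i)
      have h2 : α (t₀ + i) * (1 + ‖w (t₀ + i) ω‖) ≤ a i * g (t₀ + i) :=
        mul_le_mul_of_nonneg_left (hω _) (hα _)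
      have h3 : 0 ≤ a i * g (t₀ + i) := mul_nonneg (hα _) (htame.growth_nonneg i)
      calc K * ‖w (t₀ + (i + 1)) ω - w (t₀ + i) ω‖
          ≤ K * ((L + 1) * (α (t₀ + i) * (1 + ‖w (t₀ + i) ω‖))) :=
            mul_le_mul_of_nonneg_left h1 hK
        _ ≤ K * ((L + 2) * (a i * g (t₀ + i))) := by
            refine mul_le_mul_of_nonneg_left ?_ hK
            exact mul_le_mul (by linarith) h2 (mul_nonneg (hα _) (by positivity)) (by linarith)
        _ = _ := by ring
  have key := norm_le_decay_mul (a := a) (κ := κ) (x := fun n => w (t₀ + n) ω - wstar)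
    (g := fun n => meanOp d H (w (t₀ + n) ω) - wstar)
    (ξ := fun i => H (w (t₀ + i) ω) (Y (t₀ + i + 1) ω) - meanOp d H (w (t₀ + i) ω))
    (U := fun n => (g t₀ + ‖wstar‖) + B +
      c * (Real.log (1 / δ) + c + 2 * Real.log ((n : ℝ) + 1)))
    (fun n => hα _) htame.le_half hκ0 hκ1 (fun n => ?_) (fun n => ?_) (fun m n hmn => ?_) hξ n
  · refine key.trans (mul_le_mul_of_nonneg_left (add_le_add_left ?_ _) (decay_pos (fun j => ?_) _).le)
    · exact (hω0 t₀ le_rfl).trans (by linarith)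
    · have h1 := htame.le_half j
      have h2 := htame.pos j
      nlinarith
  · have : w (t₀ + (n + 1)) ω = w (t₀ + n) ω +
      a n • (H (w (t₀ + n) ω) (Y (t₀ + n + 1) ω) - w (t₀ + n) ω) := rfl
    simp only [this]
    module
  · have := hκ (w (t₀ + n) ω) wstar
    rwa [hfix] at this
  · have hmn' : (m : ℝ) ≤ n := Nat.cast_le.2 hmn
    have := Real.log_le_log (show (0 : ℝ) < (m : ℝ) + 1 by positivity)
      (show (m : ℝ) + 1 ≤ (n : ℝ) + 1 by linarith)
    exact add_le_add_right (mul_le_mul_of_nonneg_left (by linarith) (by linarith)) _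

end Path

/-! ### The rate in terms of the time scale -/

theorem log_le_one_add_timeScale_pow {ν : ℝ} (hν0 : 0 < ν) (hν1 : ν < 1) (t : ℕ) :
    Real.log ((t : ℝ) + 1) ≤ (1 + timeScale ν t) ^ ⌈1 / (1 - ν)⌉₊ := by
  have hθ : 0 < 1 - ν := by linarith
  have ht : (0 : ℝ) ≤ t := Nat.cast_nonneg t
  have hT := timeScale_nonneg hν1 t
  set y := Real.log ((t : ℝ) + 1)
  have hy : 0 ≤ y := Real.log_nonneg (by linarith)
  have hyT : y ^ (1 - ν) ≤ 1 + timeScale ν t := by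
    have h : y ^ (1 - ν) = (1 - ν) * timeScale ν t := by
      rw [timeScale, mul_div_cancel₀ _ hθ.ne']
    rw [h]
    nlinarith
  calc y = (y ^ (1 - ν)) ^ (1 / (1 - ν)) := by
        rw [← Real.rpow_mul hy, mul_one_div_cancel hθ.ne', Real.rpow_one]
    _ ≤ (1 + timeScale ν t) ^ (1 / (1 - ν)) :=
        Real.rpow_le_rpow (by positivity) hyT (by positivity)
    _ ≤ (1 + timeScale ν t) ^ ((⌈1 / (1 - ν)⌉₊ : ℕ) : ℝ) :=
        Real.rpow_le_rpow_of_exponent_le (by linarith) (Nat.le_ceil _)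
    _ = _ := Real.rpow_natCast _ _

/-- Everything is absorbed into `q`: the sum of the steps and the noise bound each cost one factor
`q ^ m`. -/
theorem bracket_le_pow {B c A y S l q : ℝ} {m : ℕ} (hm : 1 ≤ m) (hB : 0 ≤ B) (hc : 1 ≤ c)
    (hA : 0 ≤ A) (hy0 : 0 ≤ y) (hl0 : 0 ≤ l) (hq1 : 1 ≤ q) (hlq : l ≤ q) (hy : y ≤ q ^ m)
    (hS : S ≤ A * (1 + y)) :
    B + (1 + 2 * S) * (B + c * (l + c + 2 * y)) ≤
      (B + (1 + 4 * A) * (B + c * (3 + c))) * (q ^ m) ^ 2 := by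
  have h1 : 1 ≤ q ^ m := one_le_pow₀ hq1
  have h2 : l ≤ q ^ m := hlq.trans (le_self_pow₀ hq1 (by omega))
  set z := q ^ m
  have h3 : B + c * (l + c + 2 * y) ≤ (B + c * (3 + c)) * z := by
    have : c * (l + c + 2 * y) ≤ c * ((3 + c) * z) :=
      mul_le_mul_of_nonneg_left (by nlinarith) (by linarith)
    nlinarith
  have h4 : 1 + 2 * S ≤ (1 + 4 * A) * z := by nlinarith
  have h5 : 0 ≤ B + c * (l + c + 2 * y) := by positivity
  have h6 : 0 ≤ (1 + 4 * A) * z := by positivity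
  calc B + (1 + 2 * S) * (B + c * (l + c + 2 * y))
      ≤ B * z ^ 2 + ((1 + 4 * A) * z) * ((B + c * (3 + c)) * z) :=
        add_le_add (le_mul_of_one_le_right hB (one_le_pow₀ h1)) (mul_le_mul h4 h3 h5 h6)
    _ = _ := by ring

section Rate

variable {E 𝒴 Ω : Type*} [NormedAddCommGroup E] [NormedSpace ℝ E] [FiniteDimensional ℝ E]
  [MeasurableSpace E] [BorelSpace E] [MeasurableSpace 𝒴] {mΩ : MeasurableSpace Ω} {μ : Measure Ω}
  [IsProbabilityMeasure μ] {ℱ : Filtration ℕ mΩ} {P : Kernel 𝒴 𝒴} [IsMarkovKernel P]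
  {Y : ℕ → Ω → 𝒴} {d : Measure 𝒴} [IsProbabilityMeasure d] {H : E → 𝒴 → E} {w0 : Ω → E}

theorem exists_sq_norm_sub_le_rate (hmix : GeometricallyMixing P d) (hY : IsMarkovChain μ ℱ P Y)
    (hH : IsRegularUpdate H) (hw0 : Measurable[ℱ 0] w0) {R : ℝ} (hR : ∀ᵐ ω ∂μ, ‖w0 ω‖ ≤ R)
    {κ : ℝ} (hκ0 : 0 ≤ κ) (hκ1 : κ < 1)
    (hκ : ∀ w w' : E, ‖meanOp d H w - meanOp d H w'‖ ≤ κ * ‖w - w'‖)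
    {wstar : E} (hfix : meanOp d H wstar = wstar) {ν Cα : ℝ} (hν0 : 0 < ν) (hν1 : ν < 1)
    (hC : 1 / (1 - κ) ≤ Cα) :
    ∃ (CTh : ℝ) (C : ℕ), 0 < CTh ∧ 1 ≤ C ∧ ∀ δ : ℝ, 0 < δ → δ < 1 →
      ENNReal.ofReal (1 - δ) ≤ μ {ω | ∀ t : ℕ,
        ‖iterates H (learningRate Cα ν) Y w0 t ω - wstar‖ ^ 2 ≤
          rateA CTh ν t * (Real.log (1 / δ) + rateB 1 ν t) ^ C} := by
  have hκ' : 0 < 1 - κ := by linarith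
  have hC0 : 0 < Cα := lt_of_lt_of_le (by positivity) hC
  have hCκ : 1 ≤ (1 - κ) * Cα := by
    rw [div_le_iff₀ hκ'] at hC
    linarith
  obtain ⟨t₀, B, c, hB, hc, hhalf, hstart, htail⟩ := exists_norm_sub_le_decay hmix hY hH hw0 hR hκ0 hκ1 hκ
    hfix hν0 hν1 hC0
  set α := learningRate Cα ν
  have hα : ∀ t, 0 < α t := learningRate_pos hC0
  set w := iterates H α Y w0
  set m := ⌈1 / (1 - ν)⌉₊
  have hm : 1 ≤ m := Nat.one_le_ceil_iff.2 (one_div_pos.2 (by linarith))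
  -- `K₁` restores the part of the time scale spent before the contraction estimate starts at `t₀`.
  set K₁ := Real.exp ((1 - κ) * Cα * timeScale ν (t₀ + 2))
  set K₂ := B + (1 + 4 * Cα) * (B + c * (3 + c))
  have hK₂ : 0 ≤ K₂ := by positivity
  set C₁ := B ^ 2 * Real.exp (timeScale ν t₀)
  have hC₁ : 0 ≤ C₁ := by positivity
  have hC₂ : 0 ≤ (K₁ * K₂) ^ 2 := sq_nonneg _
  -- `C₁` covers the times up to `t₀`, and `1` makes the constant positive. The exponent is `4 * m`
  -- because `(q ^ m) ^ 2` gets squared.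
  refine ⟨C₁ + (K₁ * K₂) ^ 2 + 1, 4 * m, by linarith, by omega, fun δ hδ hδ1 =>
    (htail δ hδ hδ1).trans (measure_mono_ae ?_)⟩
  filter_upwards [hstart] with ω hω hM t
  have hl : 0 ≤ Real.log (1 / δ) := Real.log_nonneg (by rw [le_div_iff₀ hδ]; linarith)
  have hT := timeScale_nonneg hν1 t
  set q := Real.log (1 / δ) + rateB 1 ν t with hq
  have hTq : 1 + timeScale ν t ≤ q := by rw [hq, rateB]; linarith
  have hq1 : 1 ≤ q := by linarith
  rw [rateA]
  rcases le_or_gt t t₀ with ht | ht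
  · have h1 : C₁ * Real.exp (-timeScale ν t) ≤
        (C₁ + (K₁ * K₂) ^ 2 + 1) * Real.exp (-timeScale ν t) :=
      mul_le_mul_of_nonneg_right (by linarith) (Real.exp_pos _).le
    have h2 : B ^ 2 ≤ C₁ * Real.exp (-timeScale ν t) := by
      rw [mul_assoc, ← Real.exp_add]
      refine le_mul_of_one_le_right (sq_nonneg B) (Real.one_le_exp ?_)
      linarith [timeScale_mono hν1 ht]
    calc ‖w t ω - wstar‖ ^ 2 ≤ B ^ 2 := pow_le_pow_left₀ (norm_nonneg _) (hω t ht) 2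
      _ ≤ (C₁ + (K₁ * K₂) ^ 2 + 1) * Real.exp (-timeScale ν t) := h2.trans h1
      _ ≤ _ := le_mul_of_one_le_right (by positivity) (one_le_pow₀ hq1)
  · obtain ⟨n, rfl⟩ := Nat.exists_eq_add_of_le ht.le
    have hn : (0 : ℝ) ≤ n := Nat.cast_nonneg n
    have hsum : ∑ j ∈ Finset.range n, α (t₀ + j) ≤ Cα * (1 + Real.log ((n : ℝ) + 1)) := by
      calc ∑ j ∈ Finset.range n, α (t₀ + j) ≤ ∑ j ∈ Finset.range (n + 1), α (t₀ + j) := by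
            rw [Finset.sum_range_succ]
            linarith [hα (t₀ + n)]
        _ ≤ ∑ j ∈ Finset.range (n + 1), Cα * (1 / ((j : ℝ) + 1)) := by
            refine Finset.sum_le_sum fun j _ => ?_
            rw [mul_one_div]
            exact (learningRate_antitone hC0 hν0 (by omega)).trans (learningRate_le_div hC0 hν0 j)
        _ ≤ _ := by
            rw [← Finset.mul_sum]
            exact mul_le_mul_of_nonneg_left (sum_range_inv_le_log n) hC0.le
    have hlogq : Real.log ((n : ℝ) + 1) ≤ q ^ m := by
      calc Real.log ((n : ℝ) + 1) ≤ Real.log (((t₀ + n : ℕ) : ℝ) + 1) :=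
            Real.log_le_log (by positivity) (by push_cast; linarith [Nat.cast_nonneg (α := ℝ) t₀])
        _ ≤ (1 + timeScale ν (t₀ + n)) ^ m := log_le_one_add_timeScale_pow hν0 hν1 _
        _ ≤ q ^ m := pow_le_pow_left₀ (by linarith) hTq m
    have hbr := bracket_le_pow hm hB hc hC0.le (Real.log_nonneg (by linarith)) hl hq1
      (show Real.log (1 / δ) ≤ q by rw [hq, rateB]; linarith) hlogq hsum
    set Tn := timeScale ν (t₀ + n)
    have hdecay : decay (fun j => (1 - κ) * α (t₀ + j)) n ≤ K₁ * Real.exp (-Tn) := by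
      refine (decay_le_exp (fun j => by nlinarith [hhalf j, hα (t₀ + j)]) n).trans ?_
      rw [← Real.exp_add]
      refine Real.exp_le_exp.2 ?_
      rw [← Finset.mul_sum]
      have h1 := mul_le_mul_of_nonneg_left (mul_timeScale_sub_le_sum hC0 hν0 hν1 t₀ n) hκ'.le
      nlinarith [mul_le_mul_of_nonneg_right hCκ hT]
    have hx : ‖w (t₀ + n) ω - wstar‖ ≤ K₁ * Real.exp (-Tn) * (K₂ * (q ^ m) ^ 2) := by
      refine (hM n).trans (mul_le_mul hdecay hbr ?_ (by positivity))
      have : 0 ≤ ∑ j ∈ Finset.range n, α (t₀ + j) := Finset.sum_nonneg fun j _ => (hα _).le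
      have := Real.log_nonneg (show 1 ≤ (n : ℝ) + 1 by linarith)
      positivity
    calc ‖w (t₀ + n) ω - wstar‖ ^ 2 ≤ (K₁ * Real.exp (-Tn) * (K₂ * (q ^ m) ^ 2)) ^ 2 :=
          pow_le_pow_left₀ (norm_nonneg _) hx 2
      _ = (K₁ * K₂) ^ 2 * (Real.exp (-Tn) * Real.exp (-Tn)) * q ^ (4 * m) := by ring
      -- Squaring yields `exp (-2 * Tn)`, of which the claimed rate needs only one factor.
      _ ≤ (K₁ * K₂) ^ 2 * (Real.exp (-Tn) * 1) * q ^ (4 * m) := by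
          gcongr
          exact Real.exp_le_one_iff.2 (by linarith)
      _ ≤ _ := by
          rw [mul_one]
          gcongr
          linarith

end Rate

end StochApprox

/-! ### The theorem -/

open StochApprox

theorem corollary1
    {E : Type*} [NormedAddCommGroup E] [NormedSpace ℝ E] [FiniteDimensional ℝ E]
    [MeasurableSpace E] [BorelSpace E]
    {𝒴 : Type*} [MeasurableSpace 𝒴]
    {Ω : Type*} {mΩ : MeasurableSpace Ω} (μ : Measure Ω) [IsProbabilityMeasure μ]
    (P : Kernel 𝒴 𝒴) [IsMarkovKernel P] (d : Measure 𝒴) [IsProbabilityMeasure d]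
    (hmix : StochApprox.GeometricallyMixing P d)
    (ℱ : Filtration ℕ mΩ) (Y : ℕ → Ω → 𝒴) (hY : StochApprox.IsMarkovChain μ ℱ P Y)
    (H : E → 𝒴 → E) (hH : StochApprox.IsRegularUpdate H)
    (hcontr : StochApprox.IsContraction (StochApprox.meanOp d H))
    (w0 : Ω → E) (hw0 : Measurable[ℱ 0] w0) (hw0_bdd : ∃ R : ℝ, ∀ᵐ ω ∂μ, ‖w0 ω‖ ≤ R)
    (ν : ℝ) (hν0 : 0 < ν) (hν1 : ν < 1) :
    ∃ wstar : E,
      (StochApprox.meanOp d H wstar = wstar ∧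
        ∀ w : E, StochApprox.meanOp d H w = w → w = wstar) ∧
      ∃ Cbar : ℝ, 0 < Cbar ∧ ∀ Cα : ℝ, Cbar ≤ Cα →
        ∃ (CTh CTh' : ℝ) (C : ℕ), 0 < CTh ∧ 0 < CTh' ∧ 1 ≤ C ∧
          (∀ δ : ℝ, 0 < δ → δ < 1 →
            ENNReal.ofReal (1 - δ) ≤
              μ {ω | ∀ t : ℕ,
                ‖StochApprox.iterates H (StochApprox.learningRate Cα ν) Y w0 t ω - wstar‖ ^ 2 ≤
                  StochApprox.rateA CTh ν t *
                    (Real.log (1 / δ) + StochApprox.rateB CTh' ν t) ^ C}) ∧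
          (∀ p : ℝ, 2 ≤ p → ∀ t : ℕ,
            Integrable (fun ω =>
              ‖StochApprox.iterates H (StochApprox.learningRate Cα ν) Y w0 t ω - wstar‖
                ^ (2 * p)) μ ∧
            ∫ ω, ‖StochApprox.iterates H (StochApprox.learningRate Cα ν) Y w0 t ω - wstar‖
                ^ (2 * p) ∂μ ≤
              (StochApprox.rateA CTh ν t * StochApprox.rateB CTh' ν t ^ C) ^ p +
                C * p * StochApprox.rateA CTh ν t ^ p * Real.exp (StochApprox.rateB CTh' ν t) *
                  StochApprox.realFactorial (C * p)) := by
  obtain ⟨κ, hκ0, hκ1, hκ⟩ := hcontr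
  obtain ⟨R, hR⟩ := hw0_bdd
  have hcw : ContractingWith ⟨κ, hκ0⟩ (meanOp d H) :=
    ⟨by exact_mod_cast hκ1, LipschitzWith.of_dist_le_mul fun x y => by
      rw [dist_eq_norm, dist_eq_norm]
      exact hκ x y⟩
  have : CompleteSpace E := FiniteDimensional.complete ℝ E
  have hfix : meanOp d H (ContractingWith.fixedPoint _ hcw) = ContractingWith.fixedPoint _ hcw :=
    hcw.fixedPoint_isFixedPt
  -- The threshold `1 / (1 - κ)` is what makes `(1 - κ) * Cα ≥ 1`, so that the product decays at
  -- least like `exp (-timeScale)`.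
  refine ⟨_, ⟨hfix, fun w hw => hcw.fixedPoint_unique hw⟩, 1 / (1 - κ),
    one_div_pos.2 (by linarith), fun Cα hCα => ?_⟩
  obtain ⟨CTh, C, hCTh, hC, hprob⟩ := exists_sq_norm_sub_le_rate hmix hY hH hw0 hR hκ0 hκ1 hκ
    hfix hν0 hν1 hCα
  -- With `CTh' = 1`, `rateB` is at least `1`, which let powers of the bracket absorb constants.
  refine ⟨CTh, 1, C, hCTh, one_pos, hC, hprob, fun p hp t => ?_⟩
  have hm := ((measurable_iterates hY hH (learningRate Cα ν) hw0 t).mono (ℱ.le t) le_rfl).sub_const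
    (ContractingWith.fixedPoint _ hcw)
  have hb : 0 < rateB 1 ν t := by
    have := timeScale_nonneg hν1 t
    rw [rateB]
    linarith
  have ha : 0 < rateA CTh ν t := mul_pos hCTh (Real.exp_pos _)
  have key := integral_rpow_le_of_tail (μ := μ) (fun ω => sq_nonneg _) (hm.norm.pow_const 2)
    ha hb hC
    (fun δ hδ hδ1 => (hprob δ hδ hδ1).trans (measure_mono fun ω hω => hω t))
    (show 1 ≤ p by linarith)
  simpa only [Real.rpow_mul (norm_nonneg _), Real.rpow_two] using key
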